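/- **Setting.** A differential $k$-form is written $\omega=\sum_\sigma\omega_\sigma\,dx_\sigma$, where $\sigma$ runs over the $k$-element subsets of $\{1,\dots,n\}$ and $dx_\sigma=dx_{\sigma_1}\wedge\dots\wedge dx_{\sigma_k}$ for $\sigma_1<\dots<\sigma_k$ the elements of $\sigma$. A form monomial $m=x^\alpha\,dx_\sigma$ has degree $\deg m=|\alpha|$ and linear degree $\operatorname{ldeg}m=\#\{i\notin\sigma : \alpha_i=1\}$. Let $\mathcal P_r\Lambda^k(\mathbb R^n)$ be the real span of the $k$-form monomials of degree at most $r$, and let $\mathcal H_{r,l}\Lambda^k(\mathbb R^n)$ be the span of those of degree exactly $r$ and linear degree at least $l$. Let $d$ be the exterior derivative and $\kappa$ the Koszul differential (contraction with the identity vector field), $$\kappa(p\,dx_{\sigma_1}\wedge\dots\wedge dx_{\sigma_k})=\sum_{i=1}^k(-1)^{i+1}x_{\sigma_i}\,p\;dx_{\sigma_1}\wedge\dots\wedge\widehat{dx_{\sigma_i}}\wedge\dots\wedge dx_{\sigma_k}.$$ Define $$\mathcal J_r\Lambda^k=\sum_{l\ge1}\kappa\,\mathcal H_{r+l-1,l}\Lambda^{k+1},\qquad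 \mathcal S_r\Lambda^k(\mathbb R^n)=\mathcal P_r\Lambda^k+\mathcal J_r\Lambda^k+d\mathcal J_{r+1}\Lambda^{k-1},$$ the last term being $0$ for $k=0$. For an axis-parallel box $T$, $\mathcal S_r\Lambda^k(T)$ is the space of restrictions to $T$ of elements of $\mathcal S_r\Lambda^k(\mathbb R^n)$. For a $d$-dimensional face $f$ of $T$, with the free coordinates of $f$ as coordinates on it, $\mathcal P_s\Lambda^j(f)$ is the space of restrictions to $f$ of polynomial $j$-forms of degree at most $s$ in those coordinates, and $\operatorname{tr}_f$ is the pullback of forms under the inclusion $f\hookrightarrow T$. Integration over a vertex is evaluation. **Theorem (Unisolvence).** Let $n,r\ge1$ and $0\le k\le n$, and let $T\subset\mathbb R^n$ be a cube with edges parallel to the coordinate axes, or more generally a product of $n$ closed intervals of positive finite length. Then: 1. $\mathcal S_r\Lambda^k(T)$ is finite dimensional and $$\dim\mathcal S_r\Lambda^k(T)=\sum_{d=k}^{\min(n,\lfloor r/2\rfloor+k)}2^{n-d}\binom nd\binom{r-d+2k}{d}\binom dk .$$ 2. If $\mu\in\mathcal S_r\Lambda^k(T)$ satisfies $$\int_f\operatorname{tr}_f\mu\wedge\nu=0$$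 for every integer $d$ with $k\le d\le\min(n,\lfloor r/2\rfloor+k)$, every $d$-dimensional face $f$ of $T$ and every $\nu\in\mathcal P_{r-2(d-k)}\Lambda^{d-k}(f)$, then $\mu=0$. -/

import Mathlib

namespace SerendipityForms

/-- Differential forms in the coordinates `x_i`, `i ∈ ι`, with coefficients in `R`, written in
the basic alternators: `ω : Form ι R` stands for `∑_σ ω_σ dx_σ`, where `σ` runs over the subsets
of `ι` and `dx_σ = dx_{σ_1} ∧ ⋯ ∧ dx_{σ_k}` for the elements `σ_1 < ⋯ < σ_k` of `σ`.
A `k`-form is one whose coefficients vanish unless `σ` has `k` elements. -/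
abbrev Form (ι R : Type*) : Type _ := Finset ι → R

/-- Polynomial differential forms on `ℝ^ι`. -/
abbrev PolyForm (ι : Type*) : Type _ := Form ι (MvPolynomial ι ℝ)

section Algebra

variable {ι : Type*} [Fintype ι] [LinearOrder ι]

/-- The sign `(-1)^l`, `l = #{(p, q) ∈ σ × τ | q < p}`, for which
`dx_σ ∧ dx_τ = ± dx_{σ ∪ τ}` when `σ` and `τ` are disjoint. -/
def wedgeSign (σ τ : Finset ι) : ℤ :=
  (-1) ^ ((σ ×ˢ τ).filter fun pq => pq.2 < pq.1).card

/-- The wedge product: the coefficient of `dx_ρ` in `μ ∧ ν` collects the products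
`dx_σ ∧ dx_τ` over all partitions `ρ = σ ∪ τ` into disjoint parts. -/
def wedge {R : Type*} [CommRing R] (μ ν : Form ι R) : Form ι R := fun ρ =>
  ∑ σ ∈ ρ.powerset, (wedgeSign σ (ρ \ σ) : R) * (μ σ * ν (ρ \ σ))

/-- `ε(q, σ) = (-1)^l` with `l = #{p ∈ σ | p < q}`, so that `dx_q ∧ dx_σ = ε(q, σ) dx_{σ + q}`
for `q ∉ σ`. -/
def eps (q : ι) (σ : Finset ι) : ℤ :=
  (-1) ^ (σ.filter fun p => p < q).card

/-- The form monomial `x^α dx_σ`. -/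
noncomputable def formMonomial (α : ι →₀ ℕ) (σ : Finset ι) : PolyForm ι :=
  Pi.single σ (MvPolynomial.monomial α 1)

/-- The linear degree of `x^α dx_σ`: the number of variables outside the alternator that enter
linearly. -/
def ldeg (α : ι →₀ ℕ) (σ : Finset ι) : ℕ :=
  (Finset.univ.filter fun i => i ∉ σ ∧ α i = 1).card

/-- `𝒫_r Λ^k`: polynomial `k`-forms of degree at most `r`. -/
noncomputable def polyForms (ι : Type*) [Fintype ι] [LinearOrder ι] (r k : ℕ) : Submodule ℝ (PolyForm ι) :=
  Submodule.span ℝ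
    {m | ∃ (α : ι →₀ ℕ) (σ : Finset ι), σ.card = k ∧ α.degree ≤ r ∧ m = formMonomial α σ}

/-- `ℋ_{r,l} Λ^k`: homogeneous polynomial `k`-forms of degree `r` all of whose monomials have
linear degree at least `l`, i.e. the span of those monomials. -/
noncomputable def homForms (ι : Type*) [Fintype ι] [LinearOrder ι] (r l k : ℕ) : Submodule ℝ (PolyForm ι) :=
  Submodule.span ℝ
    {m | ∃ (α : ι →₀ ℕ) (σ : Finset ι),
      σ.card = k ∧ α.degree = r ∧ l ≤ ldeg α σ ∧ m = formMonomial α σ}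

/-- The Koszul differential, `κ(p dx_σ) = ∑_{q ∈ σ} ε(q, σ - q) x_q p dx_{σ - q}`.
For `q = σ_i` (the `i`-th element of `σ`) the sign is `(-1)^(i+1)`. -/
noncomputable def koszul : PolyForm ι →ₗ[ℝ] PolyForm ι :=
  ∑ σ : Finset ι, ∑ q ∈ σ,
    LinearMap.single ℝ (fun _ : Finset ι => MvPolynomial ι ℝ) (σ.erase q) ∘ₗ
      (eps q (σ.erase q) • LinearMap.mulLeft ℝ (MvPolynomial.X q : MvPolynomial ι ℝ)) ∘ₗ
      LinearMap.proj σ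

/-- The exterior derivative, `d(p dx_σ) = ∑_q ∂_q p dx_q ∧ dx_σ`, where `dx_q ∧ dx_σ` is
`ε(q, σ) dx_{σ + q}` if `q ∉ σ` and `0` otherwise. -/
noncomputable def extDiff : PolyForm ι →ₗ[ℝ] PolyForm ι :=
  ∑ σ : Finset ι, ∑ q ∈ σᶜ,
    LinearMap.single ℝ (fun _ : Finset ι => MvPolynomial ι ℝ) (insert q σ) ∘ₗ
      (eps q σ • (MvPolynomial.pderiv (R := ℝ) q).toLinearMap) ∘ₗ
      LinearMap.proj σ

/-- `𝒥_r Λ^k = ∑_{l ≥ 1} κ ℋ_{r+l-1,l} Λ^{k+1}`. -/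
noncomputable def jForms (ι : Type*) [Fintype ι] [LinearOrder ι] (r k : ℕ) :
    Submodule ℝ (PolyForm ι) :=
  ⨆ (l : ℕ) (_ : 1 ≤ l), (homForms ι (r + l - 1) l (k + 1)).map koszul

/-- `d 𝒥_r Λ^{k-1}`, which is zero for `k = 0`. -/
noncomputable def dJForms (ι : Type*) [Fintype ι] [LinearOrder ι] (r : ℕ) :
    ℕ → Submodule ℝ (PolyForm ι)
  | 0 => ⊥
  | k + 1 => (jForms ι r k).map extDiff

/-- The polynomial space `𝒮_r Λ^k(ℝ^ι) = 𝒫_r Λ^k + 𝒥_r Λ^k + d 𝒥_{r+1} Λ^{k-1}`. -/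
noncomputable def serendipity (ι : Type*) [Fintype ι] [LinearOrder ι] (r k : ℕ) :
    Submodule ℝ (PolyForm ι) :=
  polyForms ι r k ⊔ jForms ι r k ⊔ dJForms ι (r + 1) k

end Algebra

/-- A right rectangular prism in `ℝ^ι` with edges parallel to the axes: a product of closed
intervals of positive finite length. A cube is the case of equal edge lengths. -/
structure Prism (ι : Type*) where
  lower : ι → ℝ
  upper : ι → ℝ
  lower_lt_upper : ∀ i, lower i < upper i

/-- The closed set of points of the prism. -/
abbrev Prism.carrier {ι : Type*} (T : Prism ι) : Set (ι → ℝ) := Set.Icc T.lower T.upper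

/-- Differential forms on the prism `T`, with arbitrary functions `T → ℝ` as coefficients. -/
abbrev FormOn {ι : Type*} (T : Prism ι) : Type _ := Form ι (T.carrier → ℝ)

/-- Restriction of a polynomial form on `ℝ^ι` to the prism `T`. -/
noncomputable def restrict {ι : Type*} (T : Prism ι) : PolyForm ι →ₗ[ℝ] FormOn T :=
  LinearMap.pi fun σ => LinearMap.pi fun x =>
    (MvPolynomial.aeval (R := ℝ) (x : ι → ℝ)).toLinearMap ∘ₗ LinearMap.proj σ

/-- `𝒮_r Λ^k(T)`, the restrictions to `T` of the forms in `𝒮_r Λ^k(ℝ^ι)`. -/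
noncomputable def serendipityOn {ι : Type*} [Fintype ι] [LinearOrder ι] (T : Prism ι)
    (r k : ℕ) : Submodule ℝ (FormOn T) :=
  (serendipity ι r k).map (restrict T)

/-- `𝒫_r Λ^k(T)`, the restrictions to `T` of the forms in `𝒫_r Λ^k(ℝ^ι)`. -/
noncomputable def polyFormsOn {ι : Type*} [Fintype ι] [LinearOrder ι] (T : Prism ι)
    (r k : ℕ) : Submodule ℝ (FormOn T) :=
  (polyForms ι r k).map (restrict T)

/-- The integral over the prism `T` of (the top-degree component of) a form: the coefficient of
`dx_1 ∧ ⋯ ∧ dx_n` is integrated against Lebesgue measure. On a one-point prism (`ι` empty) this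
is evaluation. -/
noncomputable def integral {ι : Type*} [Fintype ι] (T : Prism ι) (ω : FormOn T) : ℝ :=
  ∫ x : T.carrier, ω Finset.univ x
    ∂(MeasureTheory.volume : MeasureTheory.Measure (ι → ℝ)).comap Subtype.val

/-- The `d`-dimensional faces of a prism in `ℝ^ι`. The coordinates in `free` vary; every other
coordinate is fixed at the upper (`true`) or the lower (`false`) end of its interval. -/
structure Face (ι : Type*) (d : ℕ) where
  free : Finset ι
  card_free : free.card = d
  atUpper : {i : ι // i ∉ free} → Bool

section Trace

variable {ι : Type*} [DecidableEq ι] {d : ℕ}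

/-- The face as a prism in its own coordinates `x_i`, `i ∈ free`. -/
def Face.prism (f : Face ι d) (T : Prism ι) : Prism {i : ι // i ∈ f.free} where
  lower i := T.lower i
  upper i := T.upper i
  lower_lt_upper i := T.lower_lt_upper i

/-- The inclusion of the face into the prism. -/
def Face.incl (f : Face ι d) (T : Prism ι) (y : (f.prism T).carrier) : T.carrier :=
  ⟨fun i =>
    if h : i ∈ f.free then y.1 ⟨i, h⟩
    else if f.atUpper ⟨i, h⟩ then T.upper i else T.lower i, by
    constructor
    · intro i
      dsimp only
      split_ifs with h h'
      · exact y.2.1 ⟨i, h⟩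
      · exact (T.lower_lt_upper i).le
      · exact le_rfl
    · intro i
      dsimp only
      split_ifs with h h'
      · exact y.2.2 ⟨i, h⟩
      · exact le_rfl
      · exact (T.lower_lt_upper i).le⟩

/-- The trace of a form on a face, i.e. its pullback under the inclusion: the coefficient
functions are restricted to the face, and `dx_σ` is dropped unless `σ` consists of free
coordinates. -/
def Face.trace (f : Face ι d) (T : Prism ι) (μ : FormOn T) : FormOn (f.prism T) :=
  fun σ y => μ (σ.map (Function.Embedding.subtype fun i => i ∈ f.free)) (f.incl T y)

end Trace

end SerendipityForms

/-! Give the form monomial x^α dx_σ the weight β = α + 1_σ. Both d and κ preserve weight, because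
each trades a factor x_q for dx_q or back. In one weight a form is a real function on the subsets σ
with 1_σ ≤ β. There κ is the boundary map of a simplex (`bdry`), d is a coboundary weighted by the
β_q (`cobdry`), and Cartan's formula dκ + κd = |β| (`homotopy`) turns most questions about the space
into finite combinatorics.

Call a monomial s-superlinear if deg m < s + ldeg m (`superForms`). Up to terms already in 𝒫_r, 𝒥_r
Λ^k is κ of the r-superlinear (k+1)-forms, and d𝒥_{r+1} Λ^{k-1} is dκ of the (r+1)-superlinear
k-forms. Superlinearity survives d, contraction with a constant field, and traces, since fixing a
variable costs at least as much degree as linear degree. Traces commute with d, and with κ up to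
such a contraction, so 𝒮_r Λ^k restricts to 𝒮_r Λ^k on faces (`polyTrace_mem_serendipity`).

For unisolvence, induct on the dimension of the face. If the traces on all facets vanish, each
coefficient ω_σ is divisible by the bubble ∏_{i ∉ σ} (x_i - a_i)(x_i - b_i). Its monomials of top
degree are then at least quadratic in every variable outside σ. In degree above r this is
incompatible with membership in 𝒮_r (`weight_component_eq_zero`), so ω has degree at most r. The
quotient of ω_σ by its bubble is then an admissible test function, and the resulting moment is, up
to sign, the integral of a nonnegative polynomial.

For the dimension, choose in each weight a pivot variable of maximal exponent. A form c of weight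
above k + r is determined by κc and κdc, and each of these is a cycle, determined by its values on
the sets avoiding the pivot. The values that can be nonzero are indexed by the monomials with deg ≤
r + ldeg, and explicit dual forms show that they are independent (`dualMap_injOn`,
`exists_dual_form`). Those monomials are counted by separating their quadratic and linear variables
(`codes`). -/

namespace SerendipityForms

set_option linter.unusedSectionVars false

/-! ### Signs, and the weighted simplicial complex in a fixed weight. -/

section SignedComplex

variable {ι : Type*} [LinearOrder ι]

theorem eps_mul_self (q : ι) (σ : Finset ι) : eps q σ * eps q σ = 1 := by
  unfold eps
  rw [← pow_add, ← two_mul, pow_mul]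
  simp

theorem eps_ne_zero (q : ι) (σ : Finset ι) : eps q σ ≠ 0 := by
  unfold eps
  exact pow_ne_zero _ (by norm_num)

theorem eps_insert_of_lt {p q : ι} {σ : Finset ι} (hp : p ∉ σ) (h : p < q) :
    eps q (insert p σ) = -eps q σ := by
  unfold eps
  rw [Finset.filter_insert, if_pos h, Finset.card_insert_of_notMem (by simp [hp]), pow_succ]
  ring

theorem eps_insert_of_le {p q : ι} {σ : Finset ι} (h : q ≤ p) :
    eps q (insert p σ) = eps q σ := by
  unfold eps
  rw [Finset.filter_insert, if_neg (not_lt.mpr h)]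

/-- Of p and q only the smaller one changes the sign of the other. This is the antisymmetry behind
κκ = 0 and dd = 0. -/
theorem eps_swap {p q : ι} {σ : Finset ι} (hp : p ∉ σ) (hq : q ∉ σ) (hpq : p ≠ q) :
    eps q σ * eps p (insert q σ) = -(eps p σ * eps q (insert p σ)) := by
  rcases lt_or_gt_of_ne hpq with h | h
  · rw [eps_insert_of_lt hp h, eps_insert_of_le h.le]
    ring
  · rw [eps_insert_of_lt hq h, eps_insert_of_le h.le]
    ring

/-- The sign relation that cancels the mixed terms of dκ + κd. -/
theorem eps_swap' {p q : ι} {σ : Finset ι} (hp : p ∉ σ) (hq : q ∉ σ) (hpq : p ≠ q) :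
    eps p (insert q σ) * eps q (insert p σ) = -(eps q σ * eps p σ) := by
  rcases lt_or_gt_of_ne hpq with h | h
  · rw [eps_insert_of_lt hp h, eps_insert_of_le h.le]
    ring
  · rw [eps_insert_of_lt hq h, eps_insert_of_le h.le]
    ring

theorem sum_sum_eq_zero_of_antisymm {s : Finset ι} (F : ι → ι → ℝ)
    (hF : ∀ p ∈ s, ∀ q ∈ s, p ≠ q → F q p = -F p q) :
    ∑ q ∈ s, ∑ p ∈ s.erase q, F q p = 0 := by
  have h1 : ∑ q ∈ s, ∑ p ∈ s.erase q, F q p = ∑ p ∈ s, ∑ q ∈ s.erase p, F q p := by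
    apply Finset.sum_comm'
    intro x y
    simp only [Finset.mem_erase]
    tauto
  have h2 : ∑ p ∈ s, ∑ q ∈ s.erase p, F q p = -∑ q ∈ s, ∑ p ∈ s.erase q, F q p := by
    rw [← Finset.sum_neg_distrib]
    refine Finset.sum_congr rfl fun p hp => ?_
    rw [← Finset.sum_neg_distrib]
    refine Finset.sum_congr rfl fun q hq => ?_
    rw [Finset.mem_erase] at hq
    rw [hF p hp q hq.2 hq.1.symm]
  linarith

variable [Fintype ι]

/-- The Koszul differential on the coefficients of a form of fixed weight. -/
def bdry : (Finset ι → ℝ) →ₗ[ℝ] (Finset ι → ℝ) where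
  toFun c τ := ∑ q ∈ τᶜ, (eps q τ : ℝ) * c (insert q τ)
  map_add' c d := by
    ext τ
    simp [mul_add, Finset.sum_add_distrib]
  map_smul' a c := by
    ext τ
    simp only [Pi.smul_apply, smul_eq_mul, RingHom.id_apply, Finset.mul_sum]
    exact Finset.sum_congr rfl fun _ _ => by ring

/-- The exterior derivative on the coefficients of a form of weight `w`. -/
def cobdry (w : ι → ℝ) : (Finset ι → ℝ) →ₗ[ℝ] (Finset ι → ℝ) where
  toFun c ρ := ∑ q ∈ ρ, (eps q (ρ.erase q) : ℝ) * w q * c (ρ.erase q)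
  map_add' c d := by
    ext τ
    simp [mul_add, Finset.sum_add_distrib]
  map_smul' a c := by
    ext τ
    simp only [Pi.smul_apply, smul_eq_mul, RingHom.id_apply, Finset.mul_sum]
    exact Finset.sum_congr rfl fun _ _ => by ring

theorem bdry_apply (c : Finset ι → ℝ) (τ : Finset ι) :
    bdry c τ = ∑ q ∈ τᶜ, (eps q τ : ℝ) * c (insert q τ) := rfl

theorem cobdry_apply (w : ι → ℝ) (c : Finset ι → ℝ) (ρ : Finset ι) :
    cobdry w c ρ = ∑ q ∈ ρ, (eps q (ρ.erase q) : ℝ) * w q * c (ρ.erase q) := rfl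

theorem bdry_bdry (c : Finset ι → ℝ) : bdry (bdry c) = 0 := by
  ext τ
  simp only [bdry_apply, Finset.mul_sum, Pi.zero_apply]
  rw [← sum_sum_eq_zero_of_antisymm (s := τᶜ)
    (fun q p => (eps q τ : ℝ) * ((eps p (insert q τ) : ℝ) * c (insert p (insert q τ))))]
  · refine Finset.sum_congr rfl fun q _ => Finset.sum_congr ?_ fun _ _ => rfl
    rw [Finset.compl_insert]
  · intro p hp q hq hpq
    have := eps_swap (Finset.mem_compl.mp hp) (Finset.mem_compl.mp hq) hpq
    have h' : (eps q τ : ℝ) * eps p (insert q τ) = -(eps p τ * eps q (insert p τ)) := by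
      exact_mod_cast this
    rw [Finset.insert_comm p q, ← mul_assoc, h']
    ring

theorem cobdry_cobdry (w : ι → ℝ) (c : Finset ι → ℝ) : cobdry w (cobdry w c) = 0 := by
  ext ρ
  simp only [cobdry_apply, Finset.mul_sum, Pi.zero_apply]
  refine sum_sum_eq_zero_of_antisymm (s := ρ)
    (fun q p => (eps q (ρ.erase q) : ℝ) * w q *
      ((eps p ((ρ.erase q).erase p) : ℝ) * w p * c ((ρ.erase q).erase p))) ?_
  intro p hp q hq hpq
  obtain ⟨τ, hpτ, hqτ, rfl⟩ : ∃ τ, p ∉ τ ∧ q ∉ τ ∧ ρ = insert p (insert q τ) := by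
    refine ⟨(ρ.erase q).erase p, by simp, by simp, ?_⟩
    rw [Finset.insert_comm, Finset.insert_erase, Finset.insert_erase hq] <;> simp [hp, hpq]
  have e1 : (insert p (insert q τ)).erase p = insert q τ := by
    rw [Finset.erase_insert]; simp [hpq, hpτ]
  have e2 : (insert p (insert q τ)).erase q = insert p τ := by
    rw [Finset.insert_comm, Finset.erase_insert]; simp [hpq.symm, hqτ]
  rw [e1, e2, Finset.erase_insert hpτ, Finset.erase_insert hqτ]
  have := eps_swap hpτ hqτ hpq
  have h' : (eps q τ : ℝ) * eps p (insert q τ) = -(eps p τ * eps q (insert p τ)) := by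
    exact_mod_cast this
  linear_combination (w q * w p * c τ) * h'

/-- Removing and restoring q ∈ σ, or adding and deleting q ∉ σ, contributes w_q times the
coefficient at σ; the terms that exchange two different elements cancel. The weight is left
arbitrary because a truncation of β is also used, in `weight_component_eq_zero`. -/
theorem homotopy (w : ι → ℝ) (c : Finset ι → ℝ) :
    cobdry w (bdry c) + bdry (cobdry w c) = (∑ i, w i) • c := by
  ext σ
  simp only [Pi.add_apply, Pi.smul_apply, smul_eq_mul, bdry_apply, cobdry_apply, Finset.mul_sum]
  have hA : ∑ q ∈ σ, ∑ p ∈ (σ.erase q)ᶜ, (eps q (σ.erase q) : ℝ) * w q *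
        ((eps p (σ.erase q) : ℝ) * c (insert p (σ.erase q)))
      = ∑ q ∈ σ, w q * c σ + ∑ q ∈ σ, ∑ p ∈ σᶜ, (eps q (σ.erase q) : ℝ) * w q *
        ((eps p (σ.erase q) : ℝ) * c (insert p (σ.erase q))) := by
    rw [← Finset.sum_add_distrib]
    refine Finset.sum_congr rfl fun q hq => ?_
    rw [Finset.compl_erase, Finset.sum_insert (by simp [hq]), Finset.insert_erase hq]
    congr 1
    have : (eps q (σ.erase q) : ℝ) * eps q (σ.erase q) = 1 := by
      exact_mod_cast eps_mul_self q (σ.erase q)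
    linear_combination (w q * c σ) * this
  have hB : ∑ p ∈ σᶜ, ∑ q ∈ insert p σ, (eps p σ : ℝ) *
        ((eps q ((insert p σ).erase q) : ℝ) * w q * c ((insert p σ).erase q))
      = ∑ p ∈ σᶜ, w p * c σ + ∑ p ∈ σᶜ, ∑ q ∈ σ, (eps p σ : ℝ) *
        ((eps q ((insert p σ).erase q) : ℝ) * w q * c ((insert p σ).erase q)) := by
    rw [← Finset.sum_add_distrib]
    refine Finset.sum_congr rfl fun p hp => ?_
    rw [Finset.mem_compl] at hp
    rw [Finset.sum_insert hp, Finset.erase_insert hp]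
    congr 1
    have : (eps p σ : ℝ) * eps p σ = 1 := by exact_mod_cast eps_mul_self p σ
    linear_combination (w p * c σ) * this
  rw [hA, hB, Finset.sum_comm (s := σᶜ) (t := σ)]
  have hC : ∑ q ∈ σ, ∑ p ∈ σᶜ, (eps q (σ.erase q) : ℝ) * w q *
        ((eps p (σ.erase q) : ℝ) * c (insert p (σ.erase q))) +
      ∑ q ∈ σ, ∑ p ∈ σᶜ, (eps p σ : ℝ) *
        ((eps q ((insert p σ).erase q) : ℝ) * w q * c ((insert p σ).erase q)) = 0 := by
    rw [← Finset.sum_add_distrib]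
    refine Finset.sum_eq_zero fun q hq => ?_
    rw [← Finset.sum_add_distrib]
    refine Finset.sum_eq_zero fun p hp => ?_
    rw [Finset.mem_compl] at hp
    have hpq : p ≠ q := fun h => hp (h ▸ hq)
    obtain ⟨τ, hqτ, rfl⟩ : ∃ τ, q ∉ τ ∧ σ = insert q τ :=
      ⟨σ.erase q, by simp, (Finset.insert_erase hq).symm⟩
    have hpτ : p ∉ τ := fun h => hp (Finset.mem_insert_of_mem h)
    rw [Finset.erase_insert hqτ, Finset.insert_comm p q τ, Finset.erase_insert (by simp [hpq.symm, hqτ])]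
    have h' : (eps p (insert q τ) : ℝ) * eps q (insert p τ) = -(eps q τ * eps p τ) := by
      exact_mod_cast eps_swap' hpτ hqτ hpq
    linear_combination (w q * c (insert p τ)) * h'
  rw [← Finset.sum_mul, ← Finset.sum_mul, ← Finset.sum_add_sum_compl σ, add_mul]
  linarith

end SignedComplex

/-! ### Coordinate formulas for d and κ, and their action on weight components. -/

variable {ι : Type*} [Fintype ι] [LinearOrder ι]

theorem koszul_apply (ω : PolyForm ι) (τ : Finset ι) :
    koszul ω τ = ∑ q ∈ τᶜ, eps q τ • (MvPolynomial.X q * ω (insert q τ)) := by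
  have h : koszul ω τ = ∑ σ : Finset ι, ∑ q ∈ σ,
      if τ = σ.erase q then eps q (σ.erase q) • (MvPolynomial.X q * ω σ) else 0 := by
    simp [koszul, LinearMap.sum_apply, Finset.sum_apply, Pi.single_apply]
  rw [h, Finset.sum_sigma', ← Finset.sum_filter]
  symm
  refine Finset.sum_bij' (fun q _ => ⟨insert q τ, q⟩) (fun x _ => x.2) ?_ ?_ ?_ ?_ ?_
  · intro q hq
    simp only [Finset.mem_compl] at hq
    simp [Finset.erase_insert hq]
  · rintro ⟨σ, q⟩ hq
    simp only [Finset.mem_filter, Finset.mem_sigma, Finset.mem_univ, true_and] at hq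
    simp [hq.2]
  · intro q hq
    rfl
  · rintro ⟨σ, q⟩ hq
    simp only [Finset.mem_filter, Finset.mem_sigma, Finset.mem_univ, true_and] at hq
    obtain ⟨h1, rfl⟩ := hq
    simp [Finset.insert_erase h1]
  · intro q hq
    simp only [Finset.mem_compl] at hq
    simp [Finset.erase_insert hq]

theorem extDiff_apply (ω : PolyForm ι) (ρ : Finset ι) :
    extDiff ω ρ = ∑ q ∈ ρ, eps q (ρ.erase q) • MvPolynomial.pderiv q (ω (ρ.erase q)) := by
  have h : extDiff ω ρ = ∑ σ : Finset ι, ∑ q ∈ σᶜ,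
      if ρ = insert q σ then eps q σ • MvPolynomial.pderiv q (ω σ) else 0 := by
    simp [extDiff, LinearMap.sum_apply, Finset.sum_apply, Pi.single_apply]
  rw [h, Finset.sum_sigma', ← Finset.sum_filter]
  symm
  refine Finset.sum_bij' (fun q _ => ⟨ρ.erase q, q⟩) (fun x _ => x.2) ?_ ?_ ?_ ?_ ?_
  · intro q hq
    simp [Finset.insert_erase hq]
  · rintro ⟨σ, q⟩ hq
    simp only [Finset.mem_filter, Finset.mem_sigma, Finset.mem_univ, true_and] at hq
    simp [hq.2]
  · intro q hq
    rfl
  · rintro ⟨σ, q⟩ hq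
    simp only [Finset.mem_filter, Finset.mem_sigma, Finset.mem_univ, true_and,
      Finset.mem_compl] at hq
    obtain ⟨h1, rfl⟩ := hq
    simp [Finset.erase_insert h1]
  · intro q hq
    rfl

/-- The exponent of `∏_{i ∈ σ} x_i`. -/
noncomputable def ind (σ : Finset ι) : ι →₀ ℕ := Finsupp.indicator σ fun _ _ => 1

theorem ind_apply (σ : Finset ι) (i : ι) : ind σ i = if i ∈ σ then 1 else 0 := by
  simp [ind, Finsupp.indicator_apply]

theorem ind_insert {q : ι} {τ : Finset ι} (h : q ∉ τ) :
    ind (insert q τ) = ind τ + Finsupp.single q 1 := by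
  ext i
  simp only [ind_apply, Finsupp.add_apply, Finsupp.single_apply, Finset.mem_insert]
  by_cases hi : i = q
  · subst hi; simp [h]
  · simp [hi, Ne.symm hi]

theorem degree_ind (σ : Finset ι) : (ind σ).degree = σ.card := by
  rw [Finsupp.degree_eq_sum]
  simp [ind_apply]

theorem ind_le_iff {σ : Finset ι} {β : ι →₀ ℕ} : ind σ ≤ β ↔ ∀ i ∈ σ, 1 ≤ β i := by
  rw [Finsupp.le_def]
  refine forall_congr' fun i => ?_
  rw [ind_apply]
  by_cases h : i ∈ σ <;> simp [h]

/-- The part of weight `β` of a form, where `x^α dx_σ` has weight `α + 1_σ`. -/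
noncomputable def comp (β : ι →₀ ℕ) : PolyForm ι →ₗ[ℝ] (Finset ι → ℝ) :=
  LinearMap.pi fun σ =>
    if ind σ ≤ β then MvPolynomial.lcoeff ℝ (β - ind σ) ∘ₗ LinearMap.proj σ else 0

theorem comp_apply (β : ι →₀ ℕ) (ω : PolyForm ι) (σ : Finset ι) :
    comp β ω σ = if ind σ ≤ β then (ω σ).coeff (β - ind σ) else 0 := by
  unfold comp
  rw [LinearMap.pi_apply]
  split_ifs <;> simp

theorem coeff_eq_comp (ω : PolyForm ι) (σ : Finset ι) (α : ι →₀ ℕ) :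
    (ω σ).coeff α = comp (α + ind σ) ω σ := by
  rw [comp_apply, if_pos (by simp), add_tsub_cancel_right]

theorem eq_zero_of_comp {ω : PolyForm ι} (h : ∀ β, comp β ω = 0) : ω = 0 := by
  ext σ α
  rw [coeff_eq_comp, h]
  simp

theorem comp_koszul (β : ι →₀ ℕ) (ω : PolyForm ι) :
    comp β (koszul ω) = bdry (comp β ω) := by
  ext τ
  rw [comp_apply, koszul_apply, bdry_apply]
  split_ifs with h
  · rw [MvPolynomial.coeff_sum]
    refine Finset.sum_congr rfl fun q hq => ?_
    rw [Finset.mem_compl] at hq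
    rw [MvPolynomial.coeff_smul, zsmul_eq_mul, MvPolynomial.coeff_X_mul', comp_apply,
      ind_insert hq]
    congr 1
    have hle : ind τ + Finsupp.single q 1 ≤ β ↔ q ∈ (β - ind τ).support := by
      rw [← ind_insert hq, ind_le_iff, Finset.forall_mem_insert]
      simp [ind_apply, hq, Nat.one_le_iff_ne_zero]
      intro _ i hi
      simpa [Nat.one_le_iff_ne_zero] using ind_le_iff.mp h i hi
    simp only [hle, tsub_add_eq_tsub_tsub]
  · symm
    refine Finset.sum_eq_zero fun q hq => ?_
    rw [comp_apply, if_neg, mul_zero]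
    intro h'
    apply h
    rw [ind_le_iff] at h' ⊢
    exact fun i hi => h' i (Finset.mem_insert_of_mem hi)

theorem comp_extDiff (β : ι →₀ ℕ) (ω : PolyForm ι) :
    comp β (extDiff ω) = cobdry (fun i => (β i : ℝ)) (comp β ω) := by
  ext ρ
  rw [comp_apply, extDiff_apply, cobdry_apply]
  split_ifs with h
  · rw [MvPolynomial.coeff_sum]
    refine Finset.sum_congr rfl fun q hq => ?_
    obtain ⟨τ, hqτ, rfl⟩ : ∃ τ, q ∉ τ ∧ ρ = insert q τ :=
      ⟨ρ.erase q, by simp, (Finset.insert_erase hq).symm⟩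
    rw [Finset.erase_insert hqτ, MvPolynomial.coeff_smul, zsmul_eq_mul, MvPolynomial.coeff_pderiv,
      comp_apply, if_pos, ind_insert hqτ]
    · have hβ : 1 ≤ β q := ind_le_iff.mp h q (by simp)
      rw [ind_insert hqτ] at h
      have e1 : β - (ind τ + Finsupp.single q 1) + Finsupp.single q 1 = β - ind τ := by
        rw [tsub_add_eq_tsub_tsub, tsub_add_cancel_of_le]
        exact le_tsub_of_add_le_left h
      rw [e1]
      have e2 : (((β - (ind τ + Finsupp.single q 1) : ι →₀ ℕ) q : ℕ) : ℝ) + 1 = β q := by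
        rw [Finsupp.tsub_apply, Finsupp.add_apply, ind_apply, if_neg hqτ]
        simp only [Finsupp.single_eq_same, zero_add]
        push_cast [hβ]
        ring
      rw [e2]
      ring
    · rw [ind_le_iff] at h ⊢
      exact fun i hi => h i (Finset.mem_insert_of_mem hi)
  · symm
    refine Finset.sum_eq_zero fun q hq => ?_
    rw [comp_apply]
    split_ifs with h'
    -- The target monomial has a negative exponent while the source is genuine. This happens only
    -- for β_q = 0, and then the weight factor kills the term.
    · have : β q = 0 := by
        by_contra h0
        apply h
        rw [ind_le_iff] at h' ⊢
        intro i hi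
        by_cases hiq : i = q
        · subst hiq; omega
        · exact h' i (Finset.mem_erase.mpr ⟨hiq, hi⟩)
      simp [this]
    · simp

theorem comp_formMonomial (β α : ι →₀ ℕ) (σ : Finset ι) :
    comp β (formMonomial α σ) = if β = α + ind σ then Pi.single σ 1 else 0 := by
  ext τ
  rw [comp_apply, formMonomial]
  by_cases hτ : τ = σ
  · subst hτ
    rw [Pi.single_eq_same, MvPolynomial.coeff_monomial]
    by_cases hβ : β = α + ind τ
    · subst hβ
      simp
    · rw [if_neg hβ]
      split_ifs with h1 h2
      · exact absurd (by rw [h2, tsub_add_cancel_of_le h1]) hβ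
      · rfl
      · rfl
  · have : (if β = α + ind σ then (Pi.single σ 1 : Finset ι → ℝ) else 0) τ = 0 := by
      split_ifs <;> simp [hτ]
    rw [this, Pi.single_eq_of_ne hτ]
    simp

theorem extDiff_extDiff (ω : PolyForm ι) : extDiff (extDiff ω) = 0 :=
  eq_zero_of_comp fun β => by rw [comp_extDiff, comp_extDiff, cobdry_cobdry]

theorem sum_eq_degree (β : ι →₀ ℕ) : ∑ i, (β i : ℝ) = β.degree := by
  rw [Finsupp.degree_eq_sum]
  push_cast
  rfl

theorem homotopy_formMonomial (α : ι →₀ ℕ) (σ : Finset ι) :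
    extDiff (koszul (formMonomial α σ)) + koszul (extDiff (formMonomial α σ))
      = ((α.degree + σ.card : ℕ) : ℝ) • formMonomial α σ := by
  rw [← sub_eq_zero]
  refine eq_zero_of_comp fun β => ?_
  rw [map_sub, map_add, map_smul, comp_extDiff, comp_koszul, comp_koszul, comp_extDiff,
    homotopy, sum_eq_degree, comp_formMonomial]
  split_ifs with h
  · rw [h, map_add, degree_ind, sub_self]
  · simp

/-! ### Spans of form monomials, and linear degree. -/

/-- The span of the form monomials `x^α dx_σ` with `P α σ`. -/
noncomputable def monoForms (P : (ι →₀ ℕ) → Finset ι → Prop) : Submodule ℝ (PolyForm ι) :=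
  Submodule.span ℝ {m | ∃ (α : ι →₀ ℕ) (σ : Finset ι), P α σ ∧ m = formMonomial α σ}

theorem coeff_formMonomial (α γ : ι →₀ ℕ) (σ τ : Finset ι) :
    (formMonomial α σ τ).coeff γ = if τ = σ ∧ α = γ then 1 else 0 := by
  unfold formMonomial
  by_cases h : τ = σ
  · subst h
    simp [MvPolynomial.coeff_monomial]
  · simp [h]

theorem form_eq_sum (ω : PolyForm ι) :
    ω = ∑ σ, ∑ α ∈ (ω σ).support, (ω σ).coeff α • formMonomial α σ := by
  ext τ γ
  rw [Finset.sum_apply, MvPolynomial.coeff_sum, Finset.sum_eq_single τ]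
  · simp only [Finset.sum_apply, MvPolynomial.coeff_sum, Pi.smul_apply, MvPolynomial.coeff_smul,
      coeff_formMonomial, true_and, smul_eq_mul, mul_ite, mul_one, mul_zero]
    rw [Finset.sum_ite_eq']
    split_ifs with h
    · rfl
    · simpa using h
  · intro σ _ hσ
    simp [MvPolynomial.coeff_sum, coeff_formMonomial, hσ.symm]
  · simp

theorem mem_monoForms {P : (ι →₀ ℕ) → Finset ι → Prop} {ω : PolyForm ι} :
    ω ∈ monoForms P ↔ ∀ σ α, (ω σ).coeff α ≠ 0 → P α σ := by
  constructor
  · intro h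
    induction h using Submodule.span_induction with
    | mem x hx =>
      obtain ⟨α, σ, hP, rfl⟩ := hx
      intro τ γ hc
      rw [coeff_formMonomial] at hc
      split_ifs at hc with h
      · rw [h.1, ← h.2]
        exact hP
      · exact absurd rfl hc
    | zero => simp
    | add x y _ _ hx hy =>
      intro σ α hc
      rw [Pi.add_apply, MvPolynomial.coeff_add] at hc
      by_cases h : (x σ).coeff α = 0
      · exact hy σ α (by simpa [h] using hc)
      · exact hx σ α h
    | smul a x _ hx =>
      intro σ α hc
      rw [Pi.smul_apply, MvPolynomial.coeff_smul] at hc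
      exact hx σ α (right_ne_zero_of_smul hc)
  · intro h
    rw [form_eq_sum ω]
    refine Submodule.sum_mem _ fun σ _ => Submodule.sum_mem _ fun α hα => Submodule.smul_mem _ _ ?_
    exact Submodule.subset_span ⟨α, σ, h σ α (MvPolynomial.mem_support_iff.mp hα), rfl⟩

theorem formMonomial_mem_monoForms {P : (ι →₀ ℕ) → Finset ι → Prop} {α : ι →₀ ℕ} {σ : Finset ι}
    (h : P α σ) : formMonomial α σ ∈ monoForms P :=
  Submodule.subset_span ⟨α, σ, h, rfl⟩

theorem monoForms_mono {P Q : (ι →₀ ℕ) → Finset ι → Prop} (h : ∀ α σ, P α σ → Q α σ) :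
    monoForms P ≤ monoForms Q := fun _ hω =>
  mem_monoForms.mpr fun σ α hc => h α σ (mem_monoForms.mp hω σ α hc)

theorem polyForms_eq (r k : ℕ) :
    polyForms ι r k = monoForms fun α σ => σ.card = k ∧ α.degree ≤ r := by
  simp only [polyForms, monoForms, and_assoc]

theorem homForms_eq (r l k : ℕ) :
    homForms ι r l k = monoForms fun α σ => σ.card = k ∧ α.degree = r ∧ l ≤ ldeg α σ := by
  simp only [homForms, monoForms, and_assoc]

theorem koszul_mem_monoForms {P Q : (ι →₀ ℕ) → Finset ι → Prop}
    (h : ∀ α q τ, q ∉ τ → P α (insert q τ) → Q (α + Finsupp.single q 1) τ)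
    {ω : PolyForm ι} (hω : ω ∈ monoForms P) : koszul ω ∈ monoForms Q := by
  rw [mem_monoForms] at hω ⊢
  intro τ α hc
  rw [koszul_apply, MvPolynomial.coeff_sum] at hc
  obtain ⟨q, hq, hc⟩ := Finset.exists_ne_zero_of_sum_ne_zero hc
  rw [Finset.mem_compl] at hq
  rw [MvPolynomial.coeff_smul, zsmul_eq_mul, MvPolynomial.coeff_X_mul'] at hc
  have hc := right_ne_zero_of_mul hc
  split_ifs at hc with hm
  · have := h _ q τ hq (hω _ _ hc)
    rwa [tsub_add_cancel_of_le] at this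
    rw [Finsupp.single_le_iff]
    exact Nat.one_le_iff_ne_zero.mpr (Finsupp.mem_support_iff.mp hm)
  · exact absurd rfl hc

theorem extDiff_mem_monoForms {P Q : (ι →₀ ℕ) → Finset ι → Prop}
    (h : ∀ α q τ, q ∉ τ → P (α + Finsupp.single q 1) τ → Q α (insert q τ))
    {ω : PolyForm ι} (hω : ω ∈ monoForms P) : extDiff ω ∈ monoForms Q := by
  rw [mem_monoForms] at hω ⊢
  intro ρ α hc
  rw [extDiff_apply, MvPolynomial.coeff_sum] at hc
  obtain ⟨q, hq, hc⟩ := Finset.exists_ne_zero_of_sum_ne_zero hc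
  rw [MvPolynomial.coeff_smul, zsmul_eq_mul, MvPolynomial.coeff_pderiv] at hc
  have hc := left_ne_zero_of_mul (right_ne_zero_of_mul hc)
  have := h α q (ρ.erase q) (by simp) (hω _ _ hc)
  rwa [Finset.insert_erase hq] at this

theorem ldeg_insert_le_ldeg (α : ι →₀ ℕ) (q : ι) (τ : Finset ι) :
    ldeg α (insert q τ) ≤ ldeg α τ := by
  refine Finset.card_le_card fun i => ?_
  simp only [Finset.mem_filter, Finset.mem_univ, true_and, Finset.mem_insert, not_or]
  rintro ⟨⟨h1, h2⟩, h3⟩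
  exact ⟨h2, h3⟩

theorem ldeg_add_single_le (α : ι →₀ ℕ) (q : ι) (τ : Finset ι) :
    ldeg (α + Finsupp.single q 1) τ ≤ ldeg α (insert q τ) + 1 := by
  refine (Finset.card_le_card (t := insert q (Finset.univ.filter
    fun i => i ∉ insert q τ ∧ α i = 1)) fun i => ?_).trans (Finset.card_insert_le _ _)
  simp only [Finset.mem_filter, Finset.mem_univ, true_and, Finset.mem_insert, not_or]
  rintro ⟨h1, h2⟩
  by_cases h : i = q
  · exact Or.inl h
  · exact Or.inr ⟨⟨h, h1⟩, by simpa [Ne.symm h] using h2⟩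

theorem ldeg_sub_ind (β : ι →₀ ℕ) (σ : Finset ι) : ldeg (β - ind σ) σ = ldeg β σ := by
  unfold ldeg
  congr 1
  ext i
  simp only [Finset.mem_filter, Finset.mem_univ, true_and, Finsupp.tsub_apply, ind_apply]
  refine and_congr_right fun h => ?_
  simp [h]

theorem ldeg_add_ind (α : ι →₀ ℕ) (σ : Finset ι) : ldeg (α + ind σ) σ = ldeg α σ := by
  rw [← ldeg_sub_ind, add_tsub_cancel_right]

/-! ### Superlinear forms and the serendipity space. -/

/-- The span of the `k`-form monomials whose degree is less than `s` plus their linear degree. -/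
noncomputable def superForms (ι : Type*) [Fintype ι] [LinearOrder ι] (s k : ℕ) :
    Submodule ℝ (PolyForm ι) :=
  monoForms fun α σ => σ.card = k ∧ α.degree < s + ldeg α σ

theorem koszul_mem_polyForms {r k : ℕ} {ω : PolyForm ι} (h : ω ∈ polyForms ι r (k + 1)) :
    koszul ω ∈ polyForms ι (r + 1) k := by
  rw [polyForms_eq] at h ⊢
  refine koszul_mem_monoForms ?_ h
  rintro α q τ hq ⟨h1, h2⟩
  rw [Finset.card_insert_of_notMem hq] at h1
  rw [map_add, Finsupp.degree_single]
  omega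

theorem extDiff_mem_polyForms {r k : ℕ} {ω : PolyForm ι} (h : ω ∈ polyForms ι (r + 1) k) :
    extDiff ω ∈ polyForms ι r (k + 1) := by
  rw [polyForms_eq] at h ⊢
  refine extDiff_mem_monoForms ?_ h
  rintro α q τ hq ⟨h1, h2⟩
  rw [Finset.card_insert_of_notMem hq]
  rw [map_add, Finsupp.degree_single] at h2
  omega

/-- Reconciles dκ on 0-forms with the convention that the third summand of 𝒮_r Λ^0 is zero. -/
theorem koszul_eq_zero_of_card_zero {P : (ι →₀ ℕ) → Finset ι → Prop}
    (hP : ∀ α σ, P α σ → σ.card = 0) {ω : PolyForm ι} (h : ω ∈ monoForms P) : koszul ω = 0 := by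
  have : koszul ω ∈ monoForms fun (_ : ι →₀ ℕ) (_ : Finset ι) => False := by
    refine koszul_mem_monoForms ?_ h
    intro α q τ hq h1
    have := hP _ _ h1
    rw [Finset.card_insert_of_notMem hq] at this
    omega
  ext σ α
  by_contra hc
  exact mem_monoForms.mp this σ α hc

/-- A partial derivative lowers the degree by one and costs at most one linear variable. -/
theorem extDiff_mem_superForms {s k : ℕ} {ω : PolyForm ι} (h : ω ∈ superForms ι s k) :
    extDiff ω ∈ superForms ι s (k + 1) := by
  refine extDiff_mem_monoForms ?_ h
  rintro α q τ hq ⟨h1, h2⟩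
  rw [Finset.card_insert_of_notMem hq]
  rw [map_add, Finsupp.degree_single] at h2
  have := ldeg_add_single_le α q τ
  omega

theorem superForms_mono {s t k : ℕ} (h : s ≤ t) : superForms ι s k ≤ superForms ι t k :=
  monoForms_mono fun _ _ ⟨h1, h2⟩ => ⟨h1, by omega⟩

/-- Below degree r, κ lands in 𝒫_r; from degree r on, superlinearity is exactly the condition
defining 𝒥_r. -/
theorem koszul_mem_serendipity {r k : ℕ} {ω : PolyForm ι} (h : ω ∈ superForms ι r (k + 1)) :
    koszul ω ∈ serendipity ι r k := by
  suffices superForms ι r (k + 1) ≤ (serendipity ι r k).comap koszul from this h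
  refine Submodule.span_le.mpr ?_
  rintro _ ⟨α, σ, ⟨h1, h2⟩, rfl⟩
  change koszul _ ∈ serendipity ι r k
  by_cases hd : α.degree < r
  · obtain ⟨r, rfl⟩ : ∃ t, r = t + 1 := ⟨r - 1, by omega⟩
    refine Submodule.mem_sup_left (Submodule.mem_sup_left (koszul_mem_polyForms ?_))
    exact Submodule.subset_span ⟨α, σ, h1, by omega, rfl⟩
  · refine Submodule.mem_sup_left (Submodule.mem_sup_right ?_)
    -- The index l is forced by deg = r + l - 1.
    refine Submodule.mem_iSup_of_mem (α.degree - r + 1) (Submodule.mem_iSup_of_mem (by omega) ?_)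
    exact Submodule.mem_map_of_mem
      (Submodule.subset_span ⟨α, σ, h1, by omega, by omega, rfl⟩)

theorem extDiff_koszul_mem_serendipity {r k : ℕ} {ω : PolyForm ι}
    (h : ω ∈ superForms ι (r + 1) k) : extDiff (koszul ω) ∈ serendipity ι r k := by
  cases k with
  | zero =>
    rw [koszul_eq_zero_of_card_zero (fun _ _ h => h.1) h, map_zero]
    exact Submodule.zero_mem _
  | succ k =>
    suffices superForms ι (r + 1) (k + 1) ≤ (serendipity ι r (k + 1)).comap (extDiff ∘ₗ koszul) from
      this h
    refine Submodule.span_le.mpr ?_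
    rintro _ ⟨α, σ, ⟨h1, h2⟩, rfl⟩
    change extDiff (koszul _) ∈ serendipity ι r (k + 1)
    by_cases hd : α.degree ≤ r
    · refine Submodule.mem_sup_left (Submodule.mem_sup_left
        (extDiff_mem_polyForms (koszul_mem_polyForms ?_)))
      exact Submodule.subset_span ⟨α, σ, h1, hd, rfl⟩
    · refine Submodule.mem_sup_right (Submodule.mem_map_of_mem ?_)
      -- For 𝒥_{r+1} the index is forced by deg = (r + 1) + l - 1.
      refine Submodule.mem_iSup_of_mem (α.degree - r) (Submodule.mem_iSup_of_mem (by omega) ?_)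
      exact Submodule.mem_map_of_mem
        (Submodule.subset_span ⟨α, σ, h1, by omega, by omega, rfl⟩)

theorem jForms_le (r k : ℕ) : jForms ι r k ≤ (superForms ι r (k + 1)).map koszul := by
  refine iSup₂_le fun l hl => Submodule.map_mono ?_
  rw [homForms_eq]
  exact monoForms_mono fun α σ ⟨h1, h2, h3⟩ => ⟨h1, by omega⟩

theorem exists_of_mem_serendipity {r k : ℕ} {ω : PolyForm ι} (h : ω ∈ serendipity ι r k) :
    ∃ p ∈ polyForms ι r k, ∃ a ∈ superForms ι r (k + 1), ∃ b ∈ superForms ι (r + 1) k,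
      ω = p + koszul a + extDiff (koszul b) := by
  obtain ⟨y, hy, z, hz, rfl⟩ := Submodule.mem_sup.mp h
  obtain ⟨p, hp, x, hx, rfl⟩ := Submodule.mem_sup.mp hy
  obtain ⟨a, ha, rfl⟩ := jForms_le r k hx
  refine ⟨p, hp, a, ha, ?_⟩
  cases k with
  | zero =>
    obtain rfl : z = 0 := by simpa [dJForms] using hz
    exact ⟨0, Submodule.zero_mem _, by simp⟩
  | succ k =>
    obtain ⟨y, hy, rfl⟩ := hz
    obtain ⟨b, hb, rfl⟩ := jForms_le _ _ hy
    exact ⟨b, hb, rfl⟩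

theorem formMonomial_eq_of_pos {α : ι →₀ ℕ} {σ : Finset ι} (h : 0 < α.degree + σ.card) :
    formMonomial α σ = ((α.degree + σ.card : ℕ) : ℝ)⁻¹ •
      (extDiff (koszul (formMonomial α σ)) + koszul (extDiff (formMonomial α σ))) := by
  rw [homotopy_formMonomial, smul_smul, inv_mul_cancel₀, one_smul]
  exact_mod_cast h.ne'

/-- By Cartan's formula m is a multiple of dκm + κ(dm), and dm is again superlinear. Only constant
0-forms escape, and they lie in 𝒫_r. -/
theorem superForms_le_serendipity (r k : ℕ) : superForms ι r k ≤ serendipity ι r k := by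
  refine Submodule.span_le.mpr ?_
  rintro _ ⟨α, σ, ⟨h1, h2⟩, rfl⟩
  have hm : formMonomial α σ ∈ superForms ι r k := formMonomial_mem_monoForms ⟨h1, h2⟩
  rcases Nat.eq_zero_or_pos (α.degree + σ.card) with h | h
  · exact Submodule.mem_sup_left (Submodule.mem_sup_left
      (Submodule.subset_span ⟨α, σ, h1, by omega, rfl⟩))
  · rw [SetLike.mem_coe, formMonomial_eq_of_pos h]
    exact Submodule.smul_mem _ _ (Submodule.add_mem _
      (extDiff_koszul_mem_serendipity (superForms_mono (Nat.le_succ r) hm))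
      (koszul_mem_serendipity (extDiff_mem_superForms hm)))

/-- Applying d to Cartan's formula makes dm a multiple of dκ(dm). -/
theorem extDiff_mem_serendipity {r k : ℕ} {ω : PolyForm ι} (hω : ω ∈ superForms ι (r + 1) k) :
    extDiff ω ∈ serendipity ι r (k + 1) := by
  suffices superForms ι (r + 1) k ≤ (serendipity ι r (k + 1)).comap extDiff from this hω
  refine Submodule.span_le.mpr ?_
  rintro _ ⟨α, σ, ⟨h1, h2⟩, rfl⟩
  change extDiff (formMonomial α σ) ∈ serendipity ι r (k + 1)
  have hm : formMonomial α σ ∈ superForms ι (r + 1) k := formMonomial_mem_monoForms ⟨h1, h2⟩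
  rcases Nat.eq_zero_or_pos (α.degree + σ.card) with h | h
  · exact Submodule.mem_sup_left (Submodule.mem_sup_left (extDiff_mem_polyForms
      (Submodule.subset_span ⟨α, σ, h1, by omega, rfl⟩)))
  · rw [formMonomial_eq_of_pos h, map_smul, map_add, extDiff_extDiff, zero_add]
    exact Submodule.smul_mem _ _ (extDiff_koszul_mem_serendipity (extDiff_mem_superForms hm))

theorem comp_ne_zero_of_mem_monoForms {P : (ι →₀ ℕ) → Finset ι → Prop} {ω : PolyForm ι}
    (h : ω ∈ monoForms P) {β : ι →₀ ℕ} {σ : Finset ι} (hc : comp β ω σ ≠ 0) :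
    ind σ ≤ β ∧ P (β - ind σ) σ := by
  rw [comp_apply] at hc
  split_ifs at hc with h1
  · exact ⟨h1, mem_monoForms.mp h σ _ hc⟩
  · exact absurd rfl hc

theorem degree_sub_ind {β : ι →₀ ℕ} {σ : Finset ι} (h : ind σ ≤ β) :
    (β - ind σ).degree + σ.card = β.degree := by
  rw [← degree_ind σ, ← map_add, tsub_add_cancel_of_le h]

/-- The weight components of degree greater than `r` of a form in `𝒮_r Λ^k`. -/
theorem exists_comp_eq {r k : ℕ} {ω : PolyForm ι} (h : ω ∈ serendipity ι r k) {β : ι →₀ ℕ}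
    (hβ : k + r < β.degree) :
    ∃ a b : Finset ι → ℝ, comp β ω = bdry a + cobdry (fun i => (β i : ℝ)) (bdry b) ∧
      (∀ σ, a σ ≠ 0 → ind σ ≤ β ∧ σ.card = k + 1 ∧ β.degree ≤ k + r + ldeg β σ) ∧
      (∀ σ, b σ ≠ 0 → ind σ ≤ β ∧ σ.card = k ∧ β.degree ≤ k + r + ldeg β σ) := by
  obtain ⟨p, hp, a, ha, b, hb, rfl⟩ := exists_of_mem_serendipity h
  refine ⟨comp β a, comp β b, ?_, fun σ hσ => ?_, fun σ hσ => ?_⟩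
  · have : comp β p = 0 := by
      ext σ
      by_contra hc
      rw [polyForms_eq] at hp
      obtain ⟨h1, h2, h3⟩ := comp_ne_zero_of_mem_monoForms hp hc
      have := degree_sub_ind h1
      omega
    rw [map_add, map_add, this, zero_add, comp_koszul, comp_extDiff, comp_koszul]
  · obtain ⟨h1, h2, h3⟩ := comp_ne_zero_of_mem_monoForms ha hσ
    rw [ldeg_sub_ind] at h3
    have := degree_sub_ind h1
    exact ⟨h1, h2, by omega⟩
  · obtain ⟨h1, h2, h3⟩ := comp_ne_zero_of_mem_monoForms hb hσ
    rw [ldeg_sub_ind] at h3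
    have := degree_sub_ind h1
    exact ⟨h1, h2, by omega⟩

/-- Every `k`-form in the serendipity space has coefficients only on `k`-element alternators. -/
theorem card_eq_of_mem_serendipity {r k : ℕ} {ω : PolyForm ι} (h : ω ∈ serendipity ι r k)
    {σ : Finset ι} (hσ : ω σ ≠ 0) : σ.card = k := by
  have key : ω ∈ monoForms fun (_ : ι →₀ ℕ) (σ : Finset ι) => σ.card = k := by
    obtain ⟨p, hp, a, ha, b, hb, rfl⟩ := exists_of_mem_serendipity h
    refine Submodule.add_mem _ (Submodule.add_mem _ ?_ ?_) ?_
    · rw [polyForms_eq] at hp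
      exact monoForms_mono (fun _ _ h => h.1) hp
    · refine koszul_mem_monoForms ?_ ha
      rintro α q τ hq ⟨h1, -⟩
      rw [Finset.card_insert_of_notMem hq] at h1
      omega
    · refine extDiff_mem_monoForms (P := fun _ τ => τ.card + 1 = k) ?_
        (koszul_mem_monoForms ?_ hb)
      · intro α q τ hq h1
        rw [Finset.card_insert_of_notMem hq, h1]
      · rintro α q τ hq ⟨h1, -⟩
        rwa [Finset.card_insert_of_notMem hq] at h1
  obtain ⟨α, hα⟩ := MvPolynomial.ne_zero_iff.mp hσ
  exact mem_monoForms.mp key σ α hα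

/-! ### Traces on faces preserve the serendipity spaces. -/

/-- Contraction with the constant vector field `v`. -/
noncomputable def contract (v : ι → ℝ) : PolyForm ι →ₗ[ℝ] PolyForm ι where
  toFun ω τ := ∑ q ∈ τᶜ, ((eps q τ : ℝ) * v q) • ω (insert q τ)
  map_add' a b := by
    ext1 τ
    simp [smul_add, Finset.sum_add_distrib]
  map_smul' a c := by
    ext1 τ
    simp only [Pi.smul_apply, RingHom.id_apply, Finset.smul_sum]
    exact Finset.sum_congr rfl fun _ _ => smul_comm _ _ _

theorem contract_apply (v : ι → ℝ) (ω : PolyForm ι) (τ : Finset ι) :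
    contract v ω τ = ∑ q ∈ τᶜ, ((eps q τ : ℝ) * v q) • ω (insert q τ) := rfl

/-- Dropping dx_q keeps the exponent and can only create linear variables. -/
theorem contract_mem_superForms (v : ι → ℝ) {s k : ℕ} {ω : PolyForm ι}
    (h : ω ∈ superForms ι s (k + 1)) : contract v ω ∈ superForms ι s k := by
  rw [superForms, mem_monoForms] at h ⊢
  intro τ α hc
  rw [contract_apply, MvPolynomial.coeff_sum] at hc
  obtain ⟨q, hq, hc⟩ := Finset.exists_ne_zero_of_sum_ne_zero hc
  rw [Finset.mem_compl] at hq
  rw [MvPolynomial.coeff_smul] at hc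
  obtain ⟨h1, h2⟩ := h _ _ (right_ne_zero_of_smul hc)
  rw [Finset.card_insert_of_notMem hq] at h1
  have := ldeg_insert_le_ldeg α q τ
  omega

/-- Substitution of the constants `c i` for the variables `x_i`, `i ∉ s`. -/
noncomputable def fixVars (s : Finset ι) (c : ι → ℝ) :
    MvPolynomial ι ℝ →ₐ[ℝ] MvPolynomial {i // i ∈ s} ℝ :=
  MvPolynomial.aeval fun i =>
    if h : i ∈ s then MvPolynomial.X ⟨i, h⟩ else MvPolynomial.C (c i)

/-- The exponent of the variables in `s`. -/
noncomputable def restrictExp (s : Finset ι) (α : ι →₀ ℕ) : {i // i ∈ s} →₀ ℕ :=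
  Finsupp.equivFunOnFinite.symm fun i => α i

theorem restrictExp_apply (s : Finset ι) (α : ι →₀ ℕ) (i : {i // i ∈ s}) :
    restrictExp s α i = α i := rfl

theorem fixVars_X_of_mem {s : Finset ι} (c : ι → ℝ) {i : ι} (h : i ∈ s) :
    fixVars s c (MvPolynomial.X i) = MvPolynomial.X ⟨i, h⟩ := by
  simp [fixVars, h]

theorem fixVars_X_of_notMem {s : Finset ι} (c : ι → ℝ) {i : ι} (h : i ∉ s) :
    fixVars s c (MvPolynomial.X i) = MvPolynomial.C (c i) := by
  simp [fixVars, h]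

theorem fixVars_monomial (s : Finset ι) (c : ι → ℝ) (α : ι →₀ ℕ) :
    ∃ a : ℝ, fixVars s c (MvPolynomial.monomial α 1) = MvPolynomial.monomial (restrictExp s α) a := by
  refine ⟨∏ i ∈ sᶜ, c i ^ α i, ?_⟩
  rw [fixVars, MvPolynomial.aeval_monomial, map_one, one_mul, Finsupp.prod_fintype _ _ (by simp),
    ← Finset.prod_compl_mul_prod s, ← Finset.prod_coe_sort s, MvPolynomial.monomial_eq,
    Finsupp.prod_fintype _ _ (by simp), map_prod]
  congr 1
  · refine Finset.prod_congr rfl fun i hi => ?_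
    rw [dif_neg (by simpa using hi), map_pow]
  · refine Finset.prod_congr rfl fun i _ => ?_
    rw [dif_pos i.2, restrictExp_apply]

theorem pderiv_fixVars {s : Finset ι} (c : ι → ℝ) {q : ι} (h : q ∈ s) (p : MvPolynomial ι ℝ) :
    fixVars s c (MvPolynomial.pderiv q p) = MvPolynomial.pderiv ⟨q, h⟩ (fixVars s c p) := by
  induction p using MvPolynomial.induction_on with
  | C a => simp [fixVars]
  | add p q hp hq => simp [hp, hq]
  | mul_X p i hp =>
    rw [Derivation.leibniz, map_mul (fixVars s c), Derivation.leibniz, map_add, smul_eq_mul,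
      smul_eq_mul, smul_eq_mul, smul_eq_mul, map_mul, map_mul, hp]
    congr 2
    by_cases hi : i ∈ s
    · rw [fixVars_X_of_mem c hi, MvPolynomial.pderiv_X, MvPolynomial.pderiv_X]
      by_cases hq : i = q
      · subst hq; simp
      · rw [Pi.single_eq_of_ne hq, Pi.single_eq_of_ne (by simpa [Subtype.ext_iff] using hq), map_zero]
    · have hq : i ≠ q := fun hq => hi (hq ▸ h)
      rw [fixVars_X_of_notMem c hi, MvPolynomial.pderiv_C, MvPolynomial.pderiv_X_of_ne hq, map_zero]

/-- The inclusion of the alternators on `s`. -/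
abbrev lift (s : Finset ι) (σ : Finset {i // i ∈ s}) : Finset ι :=
  σ.map (Function.Embedding.subtype fun i => i ∈ s)

/-- The pullback of polynomial forms to the affine subspace `x_i = c i`, `i ∉ s`. -/
noncomputable def polyTrace (s : Finset ι) (c : ι → ℝ) :
    PolyForm ι →ₗ[ℝ] PolyForm {i // i ∈ s} :=
  LinearMap.pi fun σ => (fixVars s c).toLinearMap ∘ₗ LinearMap.proj (lift s σ)

theorem polyTrace_apply (s : Finset ι) (c : ι → ℝ) (ω : PolyForm ι) (σ : Finset {i // i ∈ s}) :
    polyTrace s c ω σ = fixVars s c (ω (lift s σ)) := rfl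

theorem eps_lift {s : Finset ι} (q : {i // i ∈ s}) (τ : Finset {i // i ∈ s}) :
    eps (q : ι) (lift s τ) = eps q τ := by
  unfold eps lift
  rw [Finset.filter_map, Finset.card_map]
  rfl

theorem lift_insert {s : Finset ι} [DecidableEq {i // i ∈ s}] (q : {i // i ∈ s}) (τ : Finset {i // i ∈ s}) :
    lift s (insert q τ) = insert (q : ι) (lift s τ) := by
  ext i
  simp only [lift, Finset.mem_map, Finset.mem_insert, Function.Embedding.subtype_apply]
  aesop

theorem lift_erase {s : Finset ι} [DecidableEq {i // i ∈ s}] (q : {i // i ∈ s}) (τ : Finset {i // i ∈ s}) :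
    lift s (τ.erase q) = (lift s τ).erase (q : ι) := by
  ext i
  simp only [lift, Finset.mem_map, Finset.mem_erase, Function.Embedding.subtype_apply]
  aesop

theorem sum_compl_lift {M : Type*} [AddCommMonoid M] (s : Finset ι) (τ : Finset {i // i ∈ s})
    (g : ι → M) : ∑ q ∈ (lift s τ)ᶜ, g q = ∑ q ∈ τᶜ, g q + ∑ q ∈ sᶜ, g q := by
  have hd : Disjoint (lift s τᶜ) sᶜ := by
    rw [Finset.disjoint_left]
    intro x hx
    obtain ⟨y, _, rfl⟩ := Finset.mem_map.mp hx
    simp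
  have : (lift s τ)ᶜ = lift s τᶜ ∪ sᶜ := by
    ext i
    by_cases hi : i ∈ s <;> simp [hi, lift]
  rw [this, Finset.sum_union hd, lift, Finset.sum_map]
  rfl

/-- On the face the identity vector field splits into the identity field of the face and a constant
normal field with components c_i. The latter gives the correction. -/
theorem polyTrace_koszul (s : Finset ι) (c : ι → ℝ) (ω : PolyForm ι) :
    polyTrace s c (koszul ω) = koszul (polyTrace s c ω) +
      polyTrace s c (contract (fun i => if i ∈ s then 0 else c i) ω) := by
  ext1 τ
  rw [Pi.add_apply, polyTrace_apply, polyTrace_apply, koszul_apply, koszul_apply, contract_apply,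
    map_sum, map_sum, sum_compl_lift, sum_compl_lift, ← add_assoc]
  congr 1
  · have h0 : ∑ q ∈ τᶜ, fixVars s c (((eps (q : ι) (lift s τ) : ℝ) *
        (if (q : ι) ∈ s then 0 else c q)) • ω (insert (q : ι) (lift s τ))) = 0 :=
      Finset.sum_eq_zero fun q _ => by simp
    rw [h0, add_zero]
    refine Finset.sum_congr rfl fun q _ => ?_
    rw [map_zsmul, map_mul, fixVars_X_of_mem c q.2, eps_lift, polyTrace_apply, lift_insert]
  · refine Finset.sum_congr rfl fun q hq => ?_
    rw [Finset.mem_compl] at hq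
    rw [if_neg hq, map_zsmul, map_mul, fixVars_X_of_notMem c hq, map_smul, mul_smul,
      Int.cast_smul_eq_zsmul, MvPolynomial.smul_eq_C_mul]

theorem polyTrace_extDiff (s : Finset ι) (c : ι → ℝ) (ω : PolyForm ι) :
    polyTrace s c (extDiff ω) = extDiff (polyTrace s c ω) := by
  ext1 ρ
  rw [polyTrace_apply, extDiff_apply, extDiff_apply, map_sum, lift, Finset.sum_map]
  refine Finset.sum_congr rfl fun q _ => ?_
  change fixVars s c (eps (q : ι) ((lift s ρ).erase (q : ι)) •
    MvPolynomial.pderiv (q : ι) (ω ((lift s ρ).erase (q : ι)))) = _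
  rw [map_zsmul, pderiv_fixVars c q.2, ← lift_erase, eps_lift, polyTrace_apply]
  rfl

theorem polyTrace_mem_monoForms (s : Finset ι) (c : ι → ℝ)
    {P : (ι →₀ ℕ) → Finset ι → Prop} {Q : ({i // i ∈ s} →₀ ℕ) → Finset {i // i ∈ s} → Prop}
    (h : ∀ α σ, P α (lift s σ) → Q (restrictExp s α) σ) {ω : PolyForm ι}
    (hω : ω ∈ monoForms P) : polyTrace s c ω ∈ monoForms Q := by
  suffices monoForms P ≤ (monoForms Q).comap (polyTrace s c) from this hω
  refine Submodule.span_le.mpr ?_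
  rintro _ ⟨α, ρ, hP, rfl⟩
  rw [SetLike.mem_coe, Submodule.mem_comap, mem_monoForms]
  intro σ γ hc
  rw [polyTrace_apply, formMonomial] at hc
  by_cases hσ : lift s σ = ρ
  · subst hσ
    obtain ⟨a, ha⟩ := fixVars_monomial s c α
    rw [Pi.single_eq_same, ha, MvPolynomial.coeff_monomial] at hc
    split_ifs at hc with hγ
    · subst hγ
      exact h α σ hP
    · exact absurd rfl hc
  · rw [Pi.single_eq_of_ne hσ] at hc
    simp at hc

theorem degree_restrictExp (s : Finset ι) (α : ι →₀ ℕ) :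
    (restrictExp s α).degree + ∑ i ∈ sᶜ, α i = α.degree := by
  rw [Finsupp.degree_eq_sum, Finsupp.degree_eq_sum,
    ← Finset.sum_add_sum_compl s, ← Finset.sum_coe_sort s]
  rfl

theorem ldeg_lift_le (s : Finset ι) (α : ι →₀ ℕ) (σ : Finset {i // i ∈ s}) :
    ldeg α (lift s σ) ≤ ldeg (restrictExp s α) σ + ∑ i ∈ sᶜ, α i := by
  unfold ldeg
  rw [Finset.card_filter, Finset.card_filter,
    ← Finset.sum_add_sum_compl s, ← Finset.sum_coe_sort s]
  refine add_le_add (Finset.sum_le_sum fun i _ => ?_) (Finset.sum_le_sum fun i _ => ?_)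
  · have : (i : ι) ∈ lift s σ ↔ i ∈ σ := by simp [lift]
    simp only [restrictExp_apply, this]
    exact le_of_eq (by congr)
  · split_ifs with h
    · exact h.2.ge
    · exact Nat.zero_le _

/-- Every linear variable that gets fixed also takes away one degree, so degree minus linear degree
does not grow. -/
theorem polyTrace_mem_superForms (s : Finset ι) (c : ι → ℝ) {t k : ℕ} {ω : PolyForm ι}
    (hω : ω ∈ superForms ι t k) : polyTrace s c ω ∈ superForms {i // i ∈ s} t k := by
  refine polyTrace_mem_monoForms s c ?_ hω
  rintro α σ ⟨h1, h2⟩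
  have h3 := degree_restrictExp s α
  have h4 := ldeg_lift_le s α σ
  refine ⟨by rwa [lift, Finset.card_map] at h1, by omega⟩

/-- The contraction terms produced by κ are superlinear, so they and their differentials are
absorbed by `superForms_le_serendipity` and `extDiff_mem_serendipity`. -/
theorem polyTrace_mem_serendipity (s : Finset ι) (c : ι → ℝ) {r k : ℕ} {ω : PolyForm ι}
    (hω : ω ∈ serendipity ι r k) : polyTrace s c ω ∈ serendipity {i // i ∈ s} r k := by
  obtain ⟨p, hp, a, ha, b, hb, rfl⟩ := exists_of_mem_serendipity hω
  rw [map_add, map_add]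
  refine Submodule.add_mem _ (Submodule.add_mem _ ?_ ?_) ?_
  · refine Submodule.mem_sup_left (Submodule.mem_sup_left ?_)
    rw [polyForms_eq] at hp ⊢
    refine polyTrace_mem_monoForms s c ?_ hp
    rintro α σ ⟨h1, h2⟩
    have h3 := degree_restrictExp s α
    exact ⟨by rwa [lift, Finset.card_map] at h1, by omega⟩
  · rw [polyTrace_koszul]
    exact Submodule.add_mem _ (koszul_mem_serendipity (polyTrace_mem_superForms s c ha))
      (superForms_le_serendipity _ _
        (polyTrace_mem_superForms s c (contract_mem_superForms _ ha)))
  · cases k with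
    | zero =>
      rw [koszul_eq_zero_of_card_zero (fun _ _ h => h.1) hb, map_zero, map_zero]
      exact Submodule.zero_mem _
    | succ k =>
      rw [polyTrace_extDiff, polyTrace_koszul, map_add]
      exact Submodule.add_mem _ (extDiff_koszul_mem_serendipity (polyTrace_mem_superForms s c hb))
        (extDiff_mem_serendipity (polyTrace_mem_superForms s c (contract_mem_superForms _ hb)))

theorem restrict_apply (T : Prism ι) (ω : PolyForm ι) (σ : Finset ι) (x : T.carrier) :
    restrict T ω σ x = MvPolynomial.eval x.1 (ω σ) := by
  simp [restrict, MvPolynomial.aeval_eq_eval]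

/-- The fixed coordinates of a face. -/
noncomputable def Face.corner {d : ℕ} (f : Face ι d) (T : Prism ι) (i : ι) : ℝ :=
  if h : i ∈ f.free then 0 else if f.atUpper ⟨i, h⟩ then T.upper i else T.lower i

theorem trace_restrict {d : ℕ} (f : Face ι d) (T : Prism ι) (ω : PolyForm ι) :
    f.trace T (restrict T ω) = restrict (f.prism T) (polyTrace f.free (f.corner T) ω) := by
  ext σ y
  rw [restrict_apply, polyTrace_apply, Face.trace, restrict_apply, fixVars,
    ← MvPolynomial.coe_aeval_eq_eval, ← MvPolynomial.coe_aeval_eq_eval]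
  simp only [RingHom.coe_coe]
  rw [← AlgHom.comp_apply, MvPolynomial.comp_aeval]
  congr 2
  ext i
  rw [Face.incl]
  by_cases h : i ∈ f.free
  · simp [h]
  · simp [h, Face.corner]

/-! ### Hyperplane divisibility and bubbles. -/

/-- Substitution of the constant `a` for the variable `x_i`. -/
noncomputable def substVar (i : ι) (a : ℝ) : MvPolynomial ι ℝ →ₐ[ℝ] MvPolynomial ι ℝ :=
  MvPolynomial.aeval (Function.update MvPolynomial.X i (MvPolynomial.C a))

theorem substVar_X_self (i : ι) (a : ℝ) :
    substVar i a (MvPolynomial.X i) = MvPolynomial.C a := by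
  simp [substVar]

theorem substVar_X_of_ne {i j : ι} (h : j ≠ i) (a : ℝ) :
    substVar i a (MvPolynomial.X j) = MvPolynomial.X j := by
  simp [substVar, h]

theorem substVar_C (i : ι) (a b : ℝ) :
    substVar i a (MvPolynomial.C b) = MvPolynomial.C b := by
  simp [substVar]

theorem X_sub_C_dvd_sub_substVar (i : ι) (a : ℝ) (p : MvPolynomial ι ℝ) :
    MvPolynomial.X i - MvPolynomial.C a ∣ p - substVar i a p := by
  induction p using MvPolynomial.induction_on with
  | C b => simp
  | add p q hp hq =>
    rw [map_add, add_sub_add_comm]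
    exact dvd_add hp hq
  | mul_X p j hp =>
    rw [map_mul]
    by_cases hj : j = i
    · subst hj
      rw [substVar_X_self]
      have : p * MvPolynomial.X j - substVar j a p * MvPolynomial.C a =
        (MvPolynomial.X j - MvPolynomial.C a) * p + (p - substVar j a p) * MvPolynomial.C a := by
        ring
      rw [this]
      exact dvd_add (dvd_mul_right _ _) (hp.mul_right _)
    · rw [substVar_X_of_ne hj, ← sub_mul]
      exact hp.mul_right _

theorem substVar_linear_ne_zero {i j : ι} {a b : ℝ} (h : (i, a) ≠ (j, b)) :
    substVar j b (MvPolynomial.X i - MvPolynomial.C a : MvPolynomial ι ℝ) ≠ 0 := by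
  rw [map_sub, substVar_C]
  by_cases hij : i = j
  · subst hij
    rw [substVar_X_self, ← MvPolynomial.C_sub, Ne, MvPolynomial.C_eq_zero, sub_eq_zero]
    rintro rfl
    exact h rfl
  · rw [substVar_X_of_ne hij]
    intro h0
    have := congrArg (MvPolynomial.eval fun _ => a + 1) h0
    simp at this

/-- A polynomial vanishing on distinct hyperplanes is divisible by the product of their
equations. -/
theorem prod_linear_dvd (s : Finset (ι × ℝ)) (p : MvPolynomial ι ℝ)
    (h : ∀ x ∈ s, substVar x.1 x.2 p = 0) :
    ∏ x ∈ s, (MvPolynomial.X x.1 - MvPolynomial.C x.2) ∣ p := by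
  classical
  induction s using Finset.induction_on generalizing p with
  | empty => simp
  | insert x s hx ih =>
    have h1 := X_sub_C_dvd_sub_substVar x.1 x.2 p
    rw [h x (Finset.mem_insert_self _ _), sub_zero] at h1
    obtain ⟨q, rfl⟩ := h1
    rw [Finset.prod_insert hx]
    refine mul_dvd_mul_left _ (ih q fun y hy => ?_)
    have h2 := h y (Finset.mem_insert_of_mem hy)
    rw [map_mul] at h2
    refine (mul_eq_zero.mp h2).resolve_left (substVar_linear_ne_zero ?_)
    intro hxy
    exact hx ((Prod.ext_iff.mpr (Prod.mk.injEq .. ▸ hxy) : x = y) ▸ hy)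

/-- The bubble `∏_{i ∉ σ} (x_i - a_i) (x_i - b_i)` of a prism. -/
noncomputable def bubble (T : Prism ι) (σ : Finset ι) : MvPolynomial ι ℝ :=
  ∏ i ∈ σᶜ, (MvPolynomial.X i - MvPolynomial.C (T.lower i)) *
    (MvPolynomial.X i - MvPolynomial.C (T.upper i))

theorem bubble_dvd (T : Prism ι) (σ : Finset ι) (p : MvPolynomial ι ℝ)
    (hl : ∀ i ∉ σ, substVar i (T.lower i) p = 0) (hu : ∀ i ∉ σ, substVar i (T.upper i) p = 0) :
    bubble T σ ∣ p := by
  classical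
  have := prod_linear_dvd (σᶜ.image (fun i => (i, T.lower i)) ∪ σᶜ.image (fun i => (i, T.upper i)))
    p ?_
  · rw [Finset.prod_union, Finset.prod_image, Finset.prod_image, ← Finset.prod_mul_distrib] at this
    · exact this
    · intro i _ j _ h
      exact congrArg Prod.fst h
    · intro i _ j _ h
      exact congrArg Prod.fst h
    · rw [Finset.disjoint_left]
      rintro ⟨i, a⟩ h1 h2
      simp only [Finset.mem_image, Prod.mk.injEq] at h1 h2
      obtain ⟨j, _, rfl, rfl⟩ := h1
      obtain ⟨j', _, rfl, h⟩ := h2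
      exact (T.lower_lt_upper _).ne h.symm
  · intro x hx
    simp only [Finset.mem_union, Finset.mem_image, Finset.mem_compl] at hx
    rcases hx with ⟨i, hi, rfl⟩ | ⟨i, hi, rfl⟩
    · exact hl i hi
    · exact hu i hi

theorem totalDegree_X_sub_C (i : ι) (a : ℝ) :
    (MvPolynomial.X i - MvPolynomial.C a : MvPolynomial ι ℝ).totalDegree = 1 := by
  rw [sub_eq_add_neg, ← MvPolynomial.C_neg, MvPolynomial.totalDegree_add_eq_left_of_totalDegree_lt]
  · simp
  · simp

theorem X_sub_C_ne_zero (i : ι) (a : ℝ) :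
    (MvPolynomial.X i - MvPolynomial.C a : MvPolynomial ι ℝ) ≠ 0 := by
  intro h
  have := totalDegree_X_sub_C i a
  rw [h] at this
  simp at this

theorem bubble_ne_zero (T : Prism ι) (σ : Finset ι) : bubble T σ ≠ 0 :=
  Finset.prod_ne_zero_iff.mpr fun i _ => mul_ne_zero (X_sub_C_ne_zero i _) (X_sub_C_ne_zero i _)

theorem totalDegree_bubble (T : Prism ι) (σ : Finset ι) :
    (bubble T σ).totalDegree = 2 * σᶜ.card := by
  unfold bubble
  induction σᶜ using Finset.induction_on with
  | empty => simp
  | insert i s hi ih =>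
    rw [Finset.prod_insert hi, MvPolynomial.totalDegree_mul_of_isDomain
      (mul_ne_zero (X_sub_C_ne_zero i _) (X_sub_C_ne_zero i _)), ih,
      MvPolynomial.totalDegree_mul_of_isDomain (X_sub_C_ne_zero i _) (X_sub_C_ne_zero i _),
      totalDegree_X_sub_C, totalDegree_X_sub_C, Finset.card_insert_of_notMem hi]
    · ring
    · exact Finset.prod_ne_zero_iff.mpr fun i _ =>
        mul_ne_zero (X_sub_C_ne_zero i _) (X_sub_C_ne_zero i _)

/-- The top-degree monomials of a multiple of a quadratic polynomial in `x_i` are divisible by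
`x_i ^ 2`. -/
theorem two_le_of_coeff_ne_zero {i : ι} {a b : ℝ} {q : MvPolynomial ι ℝ} {γ : ι →₀ ℕ}
    (hdeg : ((MvPolynomial.X i - MvPolynomial.C a) * (MvPolynomial.X i - MvPolynomial.C b) *
      q).totalDegree ≤ γ.degree)
    (hc : ((MvPolynomial.X i - MvPolynomial.C a) * (MvPolynomial.X i - MvPolynomial.C b) *
      q).coeff γ ≠ 0) : 2 ≤ γ i := by
  have hq : q ≠ 0 := by
    rintro rfl
    simp at hc
  rw [MvPolynomial.totalDegree_mul_of_isDomain
      (mul_ne_zero (X_sub_C_ne_zero i _) (X_sub_C_ne_zero i _)) hq,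
      MvPolynomial.totalDegree_mul_of_isDomain (X_sub_C_ne_zero i _) (X_sub_C_ne_zero i _),
      totalDegree_X_sub_C, totalDegree_X_sub_C] at hdeg
  have hq0 : ∀ δ : ι →₀ ℕ, γ.degree < δ.degree + 2 → q.coeff δ = 0 := by
    intro δ hδ
    refine MvPolynomial.coeff_eq_zero_of_totalDegree_lt ?_
    rw [← Finsupp.degree_apply]
    omega
  -- Only the summand x_i² q can reach the degree of γ; the other two have too small a degree.
  have e : (MvPolynomial.X i - MvPolynomial.C a) * (MvPolynomial.X i - MvPolynomial.C b) * q =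
      MvPolynomial.X i * (MvPolynomial.X i * q) - MvPolynomial.C (a + b) * (MvPolynomial.X i * q)
        + MvPolynomial.C (a * b) * q := by
    rw [MvPolynomial.C_add, MvPolynomial.C_mul]
    ring
  rw [e] at hc
  by_contra hlt
  apply hc
  rw [MvPolynomial.coeff_add, MvPolynomial.coeff_sub, MvPolynomial.coeff_C_mul,
    MvPolynomial.coeff_C_mul, hq0 γ (by omega)]
  have h1 : (MvPolynomial.X i * q).coeff γ = 0 := by
    rw [MvPolynomial.coeff_X_mul']
    split_ifs with h
    · refine hq0 _ ?_
      have : (γ - Finsupp.single i 1).degree + 1 = γ.degree := by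
        conv_rhs => rw [← tsub_add_cancel_of_le (a := Finsupp.single i 1) (b := γ)
          (by rw [Finsupp.single_le_iff]; exact Nat.one_le_iff_ne_zero.mpr (by simpa using h))]
        rw [map_add, Finsupp.degree_single]
      omega
    · rfl
  have h2 : (MvPolynomial.X i * (MvPolynomial.X i * q)).coeff γ = 0 := by
    rw [MvPolynomial.coeff_X_mul']
    split_ifs with h
    · rw [MvPolynomial.coeff_X_mul', if_neg]
      simp
      omega
    · rfl
  rw [h1, h2]
  simp

/-! ### Vanishing of the components of high degree. -/

theorem bdry_apply_eq_zero {c : Finset ι → ℝ} {τ : Finset ι}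
    (h : ∀ q ∉ τ, c (insert q τ) = 0) : bdry c τ = 0 := by
  rw [bdry_apply]
  refine Finset.sum_eq_zero fun q hq => ?_
  rw [h q (Finset.mem_compl.mp hq), mul_zero]

/-- Since κκ = 0, κ forgets a, and Cartan's formula applied to κb gives κdκb = |β| κb. Dually,
`bdry_cobdry_eq_smul` forgets b because dd = 0. -/
theorem bdry_eq_smul {β : ι →₀ ℕ} {a b c : Finset ι → ℝ}
    (hc : c = bdry a + cobdry (fun i => (β i : ℝ)) (bdry b)) :
    bdry c = (β.degree : ℝ) • bdry b := by
  have := homotopy (fun i => (β i : ℝ)) (bdry b)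
  rw [bdry_bdry, map_zero, zero_add, sum_eq_degree] at this
  rw [hc, map_add, bdry_bdry, zero_add, this]

theorem bdry_cobdry_eq_smul {β : ι →₀ ℕ} {a b c : Finset ι → ℝ}
    (hc : c = bdry a + cobdry (fun i => (β i : ℝ)) (bdry b)) :
    bdry (cobdry (fun i => (β i : ℝ)) c) = (β.degree : ℝ) • bdry a := by
  have := homotopy (fun i => (β i : ℝ)) (bdry a)
  rw [bdry_bdry, map_zero, zero_add, sum_eq_degree] at this
  rw [hc, map_add, cobdry_cobdry, add_zero, this]

/-- A weight component of degree greater than `r` of a form in `𝒮_r Λ^k` vanishes if all of its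
monomials have exponent at least two in the variables outside their alternators. -/
theorem weight_component_eq_zero {r k : ℕ} (β : ι →₀ ℕ) (hβ : k + r < β.degree)
    {a b c : Finset ι → ℝ} (hc : c = bdry a + cobdry (fun i => (β i : ℝ)) (bdry b))
    (ha : ∀ σ, a σ ≠ 0 → β.degree ≤ k + r + ldeg β σ)
    (hb : ∀ σ, b σ ≠ 0 → β.degree ≤ k + r + ldeg β σ)
    (hck : ∀ σ, c σ ≠ 0 → σ.card = k)
    (hc2 : ∀ σ, c σ ≠ 0 → ind σ ≤ β ∧ ∀ i ∉ σ, 2 ≤ β i) : c = 0 := by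
  -- The truncated weight sees only the variables of exponent at least two. The proof evaluates the
  -- homotopy formula for w, instead of β, at a set where c is nonzero.
  set w : ι → ℝ := fun i => if 2 ≤ β i then (β i : ℝ) else 0 with hw
  -- If all variables outside τ have exponent at least two, τ + q has linear degree 0; as |β| > k +
  -- r, no superlinear term can sit there.
  have hvan : ∀ e : Finset ι → ℝ, (∀ σ, e σ ≠ 0 → β.degree ≤ k + r + ldeg β σ) →
      ∀ τ, (∀ i ∉ τ, 2 ≤ β i) → bdry e τ = 0 := by
    intro e he τ hτ
    refine bdry_apply_eq_zero fun q hq => ?_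
    by_contra h
    have h1 := he _ h
    have h2 : ldeg β (insert q τ) = 0 := by
      rw [ldeg, Finset.card_eq_zero, Finset.filter_eq_empty_iff]
      rintro i - ⟨h3, h4⟩
      have := hτ i fun h5 => h3 (Finset.mem_insert_of_mem h5)
      omega
    omega
  -- Truncation is invisible to c, which vanishes on every set omitting a variable of exponent below
  -- two.
  have hwc : cobdry w c = cobdry (fun i => (β i : ℝ)) c := by
    ext ρ
    rw [cobdry_apply, cobdry_apply]
    refine Finset.sum_congr rfl fun q _ => ?_
    by_cases h : 2 ≤ β q
    · simp [hw, h]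
    · have : c (ρ.erase q) = 0 := by
        by_contra h0
        exact h ((hc2 _ h0).2 q (by simp))
      rw [this, mul_zero, mul_zero]
  have hKc := bdry_eq_smul hc
  have hKDc := bdry_cobdry_eq_smul hc
  ext σ
  by_contra h0
  obtain ⟨hσ1, hσ2⟩ := hc2 σ h0
  have hmain := congrFun (homotopy w c) σ
  rw [hwc, hKDc, hKc, Pi.add_apply, Pi.smul_apply, Pi.smul_apply, hvan a ha σ hσ2, smul_zero,
    add_zero, smul_eq_mul] at hmain
  -- Here truncation is essential: only q with β_q ≥ 2 are removed from σ, so `hvan` still applies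
  -- to σ - q.
  have hz : cobdry w ((β.degree : ℝ) • bdry b) σ = 0 := by
    rw [cobdry_apply]
    refine Finset.sum_eq_zero fun q _ => ?_
    by_cases h : 2 ≤ β q
    · rw [Pi.smul_apply, hvan b hb, smul_zero, mul_zero]
      intro i hi
      by_cases hiq : i = q
      · exact hiq ▸ h
      · exact hσ2 i fun h' => hi (Finset.mem_erase.mpr ⟨hiq, h'⟩)
    · simp [hw, h]
  rw [hz] at hmain
  have hw0 : ∑ i, w i = 0 := (mul_eq_zero.mp hmain.symm).resolve_right h0
  rw [Finset.sum_eq_zero_iff_of_nonneg (fun i _ => by simp only [hw]; positivity)] at hw0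
  -- With zero total truncated weight no exponent exceeds one, so β = 1_σ and |β| = k, against |β| >
  -- k + r.
  have hβ1 : β = ind σ := by
    ext i
    have h1 : ¬ 2 ≤ β i := by
      intro h
      have := hw0 i (Finset.mem_univ i)
      simp only [hw, if_pos h] at this
      have : β i = 0 := by exact_mod_cast this
      omega
    have h2 : i ∈ σ := by
      by_contra h
      exact h1 (hσ2 i h)
    have := ind_le_iff.mp hσ1 i h2
    rw [ind_apply, if_pos h2]
    omega
  have := hck σ h0
  rw [hβ1, degree_ind] at hβ
  omega

/-- A form in `𝒮_r Λ^k` whose coefficients have bubble factors has degree at most `r`. -/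
theorem totalDegree_le_of_bubble_dvd (T : Prism ι) {r k : ℕ} {ω : PolyForm ι}
    (h : ω ∈ serendipity ι r k) (hd : ∀ σ, bubble T σ ∣ ω σ) (σ : Finset ι) :
    (ω σ).totalDegree ≤ r := by
  -- The degree is maximized over all coefficients at once: a weight component mixes coefficients,
  -- but its monomials all have the same degree, so each is of top degree.
  obtain ⟨ρ, hρ⟩ := Finite.exists_max fun σ => (ω σ).totalDegree
  refine (hρ σ).trans ?_
  by_contra hlt
  push Not at hlt
  have hρ0 : ω ρ ≠ 0 := by
    intro h0
    simp [h0] at hlt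
  have hρk := card_eq_of_mem_serendipity h hρ0
  obtain ⟨γ, hγ, hγd⟩ : ∃ γ ∈ (ω ρ).support, (ω ρ).totalDegree = γ.degree := by
    obtain ⟨γ, hγ, h1⟩ := Finset.exists_mem_eq_sup (ω ρ).support
      (MvPolynomial.support_nonempty.mpr hρ0) fun s => s.sum fun _ e => e
    refine ⟨γ, hγ, ?_⟩
    rw [Finsupp.degree_apply]
    exact h1
  have hβ : (γ + ind ρ).degree = (ω ρ).totalDegree + k := by
    rw [map_add, degree_ind, hγd, hρk]
  have hβr : k + r < (γ + ind ρ).degree := by omega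
  obtain ⟨a, b, hc, ha, hb⟩ := exists_comp_eq h hβr
  have hsupp : ∀ σ, comp (γ + ind ρ) ω σ ≠ 0 →
      ind σ ≤ γ + ind ρ ∧ ω σ ≠ 0 ∧ (ω σ).coeff (γ + ind ρ - ind σ) ≠ 0 := by
    intro σ h0
    rw [comp_apply] at h0
    split_ifs at h0 with h1
    · exact ⟨h1, fun h2 => h0 (by rw [h2]; simp), h0⟩
    · exact absurd rfl h0
  have hzero := weight_component_eq_zero (γ + ind ρ) hβr hc (fun σ h => (ha σ h).2.2)
    (fun σ h => (hb σ h).2.2)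
    (fun σ h0 => card_eq_of_mem_serendipity h (hsupp σ h0).2.1) (fun σ h0 => ?_)
  · rw [MvPolynomial.mem_support_iff, coeff_eq_comp, hzero] at hγ
    exact hγ rfl
  · obtain ⟨h1, h2, h3⟩ := hsupp σ h0
    refine ⟨h1, fun i hi => ?_⟩
    have hdvd := (Finset.dvd_prod_of_mem (fun i => (MvPolynomial.X i - MvPolynomial.C (T.lower i)) *
      (MvPolynomial.X i - MvPolynomial.C (T.upper i))) (Finset.mem_compl.mpr hi)).trans (hd σ)
    obtain ⟨q, hq⟩ := hdvd
    have hdeg : (γ + ind ρ - ind σ).degree = (ω ρ).totalDegree := by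
      have := degree_sub_ind h1
      have := card_eq_of_mem_serendipity h h2
      omega
    have := hρ σ
    rw [← hdeg] at this
    simp only [hq] at this h3
    have := two_le_of_coeff_ne_zero this h3
    rw [Finsupp.tsub_apply, ind_apply, if_neg hi] at this
    simpa using this

/-! ### Integrals over prisms, and unisolvence for vanishing trace. -/

open MeasureTheory

theorem eq_zero_of_eval_carrier (T : Prism ι) {p : MvPolynomial ι ℝ}
    (h : ∀ x ∈ T.carrier, MvPolynomial.eval x p = 0) : p = 0 := by
  refine MvPolynomial.funext_set (fun i => Set.Icc (T.lower i) (T.upper i))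
    (fun i => Set.Icc_infinite (T.lower_lt_upper i)) fun x hx => ?_
  rw [h x, map_zero]
  rw [Set.mem_univ_pi] at hx
  exact ⟨fun i => (hx i).1, fun i => (hx i).2⟩

theorem restrict_injective (T : Prism ι) : Function.Injective (restrict T) := by
  rw [← LinearMap.ker_eq_bot, LinearMap.ker_eq_bot']
  intro ω h
  ext1 σ
  refine eq_zero_of_eval_carrier T fun x hx => ?_
  rw [← restrict_apply T ω σ ⟨x, hx⟩, h]
  rfl

/-- A polynomial that is nonnegative on a prism and has integral zero vanishes. -/
theorem eq_zero_of_setIntegral_eq_zero (T : Prism ι) {p : MvPolynomial ι ℝ}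
    (h0 : ∀ x ∈ T.carrier, 0 ≤ MvPolynomial.eval x p)
    (h : ∫ x in T.carrier, MvPolynomial.eval x p = 0) : p = 0 := by
  have hcont : Continuous fun x : ι → ℝ => MvPolynomial.eval x p := p.continuous_eval
  rw [setIntegral_eq_zero_iff_of_nonneg_ae] at h
  · set U : Set (ι → ℝ) := Set.pi Set.univ fun i => Set.Ioo (T.lower i) (T.upper i) with hU
    have hUs : U ⊆ T.carrier := fun x hx =>
      ⟨fun i => (hx i (Set.mem_univ i)).1.le, fun i => (hx i (Set.mem_univ i)).2.le⟩
    have hUo : IsOpen U := isOpen_set_pi Set.finite_univ fun _ _ => isOpen_Ioo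
    -- On the open interior, almost-everywhere vanishing of a continuous function is vanishing, and
    -- a product of infinite sets detects polynomials.
    have := Measure.eqOn_open_of_ae_eq (h.filter_mono (ae_mono (Measure.restrict_mono_set _ hUs)))
      hUo hcont.continuousOn continuousOn_const
    refine MvPolynomial.funext_set (fun i => Set.Ioo (T.lower i) (T.upper i))
      (fun i => Set.Ioo_infinite (T.lower_lt_upper i)) fun x hx => ?_
    rw [map_zero]
    exact this hx
  · filter_upwards [ae_restrict_mem measurableSet_Icc] with x hx
    exact h0 x hx
  · exact hcont.continuousOn.integrableOn_Icc

theorem eval_substVar (i : ι) (a : ℝ) (p : MvPolynomial ι ℝ) (x : ι → ℝ) :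
    MvPolynomial.eval x (substVar i a p) = MvPolynomial.eval (Function.update x i a) p := by
  rw [substVar, ← MvPolynomial.coe_aeval_eq_eval, ← MvPolynomial.coe_aeval_eq_eval]
  simp only [RingHom.coe_coe]
  rw [← AlgHom.comp_apply, MvPolynomial.comp_aeval]
  congr 2
  ext j
  by_cases h : j = i
  · subst h; simp
  · simp [h]

theorem substVar_eq_zero (T : Prism ι) {i : ι} {a : ℝ} (ha : a ∈ Set.Icc (T.lower i) (T.upper i))
    {p : MvPolynomial ι ℝ} (h : ∀ x ∈ T.carrier, x i = a → MvPolynomial.eval x p = 0) :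
    substVar i a p = 0 := by
  refine eq_zero_of_eval_carrier T fun x hx => ?_
  rw [eval_substVar]
  refine h _ ⟨?_, ?_⟩ (by simp)
  · intro j
    by_cases hj : j = i
    · subst hj; simpa using ha.1
    · simpa [hj] using hx.1 j
  · intro j
    by_cases hj : j = i
    · subst hj; simpa using ha.2
    · simpa [hj] using hx.2 j

theorem eval_bubble (T : Prism ι) (σ : Finset ι) (x : ι → ℝ) :
    MvPolynomial.eval x (bubble T σ) =
      (-1) ^ σᶜ.card * ∏ i ∈ σᶜ, (x i - T.lower i) * (T.upper i - x i) := by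
  rw [bubble, map_prod, ← Finset.prod_const, ← Finset.prod_mul_distrib]
  refine Finset.prod_congr rfl fun i _ => ?_
  simp
  ring

theorem wedge_single_apply_univ {T : Prism ι} (μ : FormOn T) (σ : Finset ι) (g : T.carrier → ℝ) :
    wedge μ (Pi.single σᶜ g) Finset.univ = (wedgeSign σ σᶜ : T.carrier → ℝ) * (μ σ * g) := by
  rw [wedge, Finset.sum_eq_single σ]
  · rw [← Finset.compl_eq_univ_sdiff, Pi.single_eq_same]
  · intro τ _ hτ
    rw [← Finset.compl_eq_univ_sdiff, Pi.single_eq_of_ne (by simpa using hτ)]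
    simp
  · simp

theorem restrict_single (T : Prism ι) (σ : Finset ι) (p : MvPolynomial ι ℝ) :
    restrict T (Pi.single σ p) = Pi.single σ fun x => MvPolynomial.eval x.1 p := by
  ext τ x
  rw [restrict_apply]
  by_cases h : τ = σ
  · subst h; simp
  · simp [h]

theorem single_mem_polyForms {s k : ℕ} {σ : Finset ι} (hσ : σ.card = k) {p : MvPolynomial ι ℝ}
    (hp : p.totalDegree ≤ s) : (Pi.single σ p : PolyForm ι) ∈ polyForms ι s k := by
  rw [polyForms_eq, mem_monoForms]
  intro τ α hc
  by_cases h : τ = σ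
  · subst h
    rw [Pi.single_eq_same] at hc
    refine ⟨hσ, le_trans ?_ hp⟩
    have := MvPolynomial.le_totalDegree (MvPolynomial.mem_support_iff.mpr hc)
    rwa [Finsupp.degree_apply]
  · rw [Pi.single_eq_of_ne h] at hc
    simp at hc

/-- Unisolvence for forms with vanishing trace. -/
theorem eq_zero_of_trace_eq_zero (T : Prism ι) {r k : ℕ} {ω : PolyForm ι}
    (hω : ω ∈ serendipity ι r k)
    (hb : ∀ i σ, i ∉ σ → ∀ x : T.carrier, x.1 i = T.lower i ∨ x.1 i = T.upper i →
      restrict T ω σ x = 0)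
    (hm : k ≤ Fintype.card ι → 2 * (Fintype.card ι - k) ≤ r →
      ∀ ν ∈ polyFormsOn T (r - 2 * (Fintype.card ι - k)) (Fintype.card ι - k),
        integral T (wedge (restrict T ω) ν) = 0) : ω = 0 := by
  have hd : ∀ σ, bubble T σ ∣ ω σ := fun σ => by
    refine bubble_dvd T σ _ (fun i hi => ?_) fun i hi => ?_
    · refine substVar_eq_zero T ⟨le_rfl, (T.lower_lt_upper i).le⟩ fun x hx hxi => ?_
      rw [← restrict_apply T ω σ ⟨x, hx⟩]
      exact hb i σ hi _ (Or.inl hxi)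
    · refine substVar_eq_zero T ⟨(T.lower_lt_upper i).le, le_rfl⟩ fun x hx hxi => ?_
      rw [← restrict_apply T ω σ ⟨x, hx⟩]
      exact hb i σ hi _ (Or.inr hxi)
  ext1 σ
  by_contra h0
  rw [Pi.zero_apply] at h0
  have hσ := card_eq_of_mem_serendipity hω h0
  have hσc : σᶜ.card = Fintype.card ι - k := by rw [Finset.card_compl, hσ]
  have hdeg := totalDegree_le_of_bubble_dvd T hω hd σ
  obtain ⟨p, hp⟩ := hd σ
  have hp0 : p ≠ 0 := by
    rintro rfl
    exact h0 (by rw [hp, mul_zero])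
  rw [hp, MvPolynomial.totalDegree_mul_of_isDomain (bubble_ne_zero T σ) hp0, totalDegree_bubble,
    hσc] at hdeg
  -- With ω_σ = bubble · p, the test form is p dx_{σᶜ}; the degree bound on ω_σ leaves exactly the
  -- allowed degree for p.
  have hint := hm (hσ ▸ Finset.card_le_univ σ) (by omega) (restrict T (Pi.single σᶜ p))
    (Submodule.mem_map_of_mem (single_mem_polyForms hσc (by omega)))
  rw [integral, restrict_single, wedge_single_apply_univ] at hint
  have hint2 : ∫ x in T.carrier, MvPolynomial.eval x (ω σ * p) = 0 := by
    have hs : (wedgeSign σ σᶜ : ℝ) ≠ 0 := by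
      unfold wedgeSign
      push_cast
      exact pow_ne_zero _ (by norm_num)
    refine (mul_eq_zero.mp ?_).resolve_left hs
    rw [← integral_const_mul, ← integral_subtype_comap measurableSet_Icc, ← hint]
    refine integral_congr_ae (Filter.Eventually.of_forall fun x => ?_)
    simp [restrict_apply]
  -- The sign turns the bubble into ∏ (x_i - a_i)(b_i - x_i), which is nonnegative on the prism, so
  -- the integrand is this product times p².
  have hzero : MvPolynomial.C ((-1 : ℝ) ^ σᶜ.card) * (ω σ * p) = 0 := by
    refine eq_zero_of_setIntegral_eq_zero T (fun x hx => ?_) ?_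
    · have e : MvPolynomial.eval x (MvPolynomial.C ((-1 : ℝ) ^ σᶜ.card) * (ω σ * p)) =
          (∏ i ∈ σᶜ, (x i - T.lower i) * (T.upper i - x i)) * MvPolynomial.eval x p ^ 2 := by
        rw [hp, map_mul, map_mul, map_mul, MvPolynomial.eval_C, eval_bubble]
        have : ((-1 : ℝ) ^ σᶜ.card) * (-1) ^ σᶜ.card = 1 := by
          rw [← mul_pow]; norm_num
        linear_combination ((∏ i ∈ σᶜ, (x i - T.lower i) * (T.upper i - x i)) *
          MvPolynomial.eval x p ^ 2) * this
      rw [e]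
      refine mul_nonneg (Finset.prod_nonneg fun i _ => mul_nonneg ?_ ?_) (sq_nonneg _)
      · exact sub_nonneg.mpr (hx.1 i)
      · exact sub_nonneg.mpr (hx.2 i)
    · simp only [map_mul (MvPolynomial.eval _) (MvPolynomial.C _), MvPolynomial.eval_C]
      rw [integral_const_mul, hint2, mul_zero]
  rw [mul_eq_zero, MvPolynomial.C_eq_zero] at hzero
  rcases hzero with h | h
  · exact pow_ne_zero _ (by norm_num) h
  · exact mul_ne_zero h0 hp0 h

/-! ### Facets, and induction on the dimension of faces. -/

/-- The facet of a face on which the free coordinate `i` is fixed. -/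
def Face.facet {d : ℕ} (f : Face ι (d + 1)) (i : ι) (hi : i ∈ f.free) (u : Bool) : Face ι d where
  free := f.free.erase i
  card_free := by rw [Finset.card_erase_of_mem hi, f.card_free]; rfl
  atUpper j := if h : j.1 ∈ f.free then u else f.atUpper ⟨j.1, h⟩

/-- Because i ∉ σ, dx_σ survives restriction to the facet, so its coefficient can be read off the
trace there. -/
theorem trace_apply_eq_zero_of_facet {d : ℕ} (f : Face ι (d + 1)) (T : Prism ι) (μ : FormOn T)
    (i : {i // i ∈ f.free}) (u : Bool) (h : (f.facet i i.2 u).trace T μ = 0)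
    (σ : Finset {i // i ∈ f.free}) (hi : i ∉ σ) (y : (f.prism T).carrier)
    (hy : y.1 i = if u then T.upper i else T.lower i) : f.trace T μ σ y = 0 := by
  have hfree : ∀ j : {j // j ∈ (f.facet i i.2 u).free}, j.1 ∈ f.free :=
    fun j => Finset.mem_of_mem_erase j.2
  have h1 := congrFun (congrFun h ((lift f.free σ).subtype fun j => j ∈ (f.facet i i.2 u).free))
    ⟨fun j => y.1 ⟨j.1, hfree j⟩, fun j => y.2.1 ⟨j.1, hfree j⟩, fun j => y.2.2 ⟨j.1, hfree j⟩⟩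
  simp only [Face.trace, Pi.zero_apply] at h1 ⊢
  have hσ : ((lift f.free σ).subtype fun j => j ∈ (f.facet i i.2 u).free).map
      (Function.Embedding.subtype _) = lift f.free σ := by
    rw [Finset.subtype_map_of_mem]
    intro j hj
    obtain ⟨j, hjσ, rfl⟩ := Finset.mem_map.mp hj
    refine Finset.mem_erase.mpr ⟨?_, j.2⟩
    intro hji
    exact hi (Subtype.ext hji ▸ hjσ)
  rw [hσ] at h1
  rw [← h1]
  congr 1
  · apply Subtype.ext
    ext j
    simp only [Face.incl, Face.facet, Finset.mem_erase]
    by_cases hj : j ∈ f.free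
    · by_cases hji : j = i
      · subst hji
        simp [hj, hy]
      · simp [hj, hji]
    · simp [hj]

/-- The whole prism as a face. -/
def Face.whole (ι : Type*) [Fintype ι] : Face ι (Fintype.card ι) where
  free := Finset.univ
  card_free := rfl
  atUpper _ := true

theorem eq_zero_of_whole_trace (T : Prism ι) (μ : FormOn T) (h : (Face.whole ι).trace T μ = 0) :
    μ = 0 := by
  ext σ x
  have h1 := congrFun (congrFun h (σ.subtype fun j => j ∈ (Face.whole ι).free))
    ⟨fun j => x.1 j.1, fun j => x.2.1 j.1, fun j => x.2.2 j.1⟩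
  simp only [Face.trace, Pi.zero_apply] at h1 ⊢
  rw [← h1]
  congr 1
  · rw [Finset.subtype_map_of_mem]
    intro j _
    exact Finset.mem_univ j
  · apply Subtype.ext
    ext j
    simp [Face.incl, Face.whole]

theorem unisolvence (T : Prism ι) {r k : ℕ} {μ : FormOn T} (hμ : μ ∈ serendipityOn T r k)
    (hm : ∀ d : ℕ, k ≤ d → d ≤ min (Fintype.card ι) (r / 2 + k) → ∀ f : Face ι d,
      ∀ ν ∈ polyFormsOn (f.prism T) (r - 2 * (d - k)) (d - k),
        integral (f.prism T) (wedge (f.trace T μ) ν) = 0) : μ = 0 := by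
  obtain ⟨ω, hω, rfl⟩ := hμ
  have key : ∀ d (f : Face ι d), f.trace T (restrict T ω) = 0 := by
    intro d
    induction d with
    | zero =>
      intro f
      rw [trace_restrict, eq_zero_of_trace_eq_zero (f.prism T)
        (polyTrace_mem_serendipity f.free (f.corner T) hω), map_zero]
      -- A vertex has no free coordinate, so the boundary condition is empty.
      · intro i
        exact absurd f.card_free (Finset.card_ne_zero_of_mem i.2)
      · rw [Fintype.card_coe, f.card_free, ← trace_restrict]
        intro h1 h2
        exact hm 0 h1 (Nat.zero_le _) f
    | succ d ih =>
      intro f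
      rw [trace_restrict, eq_zero_of_trace_eq_zero (f.prism T)
        (polyTrace_mem_serendipity f.free (f.corner T) hω), map_zero]
      · intro i σ hi x hx
        rw [← trace_restrict]
        rcases hx with hx | hx
        · exact trace_apply_eq_zero_of_facet f T _ i false (ih _) σ hi x (hx.trans (by simp [Face.prism]))
        · exact trace_apply_eq_zero_of_facet f T _ i true (ih _) σ hi x (hx.trans (by simp [Face.prism]))
      · rw [Fintype.card_coe, f.card_free, ← trace_restrict]
        intro h1 h2
        refine hm (d + 1) h1 (le_min ?_ ?_) f
        · exact f.card_free ▸ Finset.card_le_univ _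
        · omega
  exact eq_zero_of_whole_trace T _ (key _ _)

/-! ### A dual system for the serendipity space. -/

theorem exists_of_bdry_ne_zero {c : Finset ι → ℝ} {τ : Finset ι} (h : bdry c τ ≠ 0) :
    ∃ q ∉ τ, c (insert q τ) ≠ 0 := by
  by_contra! hc
  exact h (bdry_apply_eq_zero hc)

/-- The simplex is a cone with apex p: in the boundary at τ - p only the value at τ survives, so a
cycle is determined by its values off p. -/
theorem eq_zero_of_bdry_eq_zero {x : Finset ι → ℝ} (p : ι) (h : bdry x = 0)
    (hx : ∀ τ, p ∉ τ → x τ = 0) : x = 0 := by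
  ext τ
  by_cases hp : p ∈ τ
  · have h1 := congrFun h (τ.erase p)
    rw [bdry_apply, Finset.sum_eq_single p, Finset.insert_erase hp] at h1
    · exact (mul_eq_zero.mp h1).resolve_left (by exact_mod_cast eps_ne_zero p _)
    · intro q _ hqp
      rw [hx _ (by simp [hqp.symm]), mul_zero]
    · simp
  · exact hx τ hp

theorem bdry_single {p : ι} {τ ρ : Finset ι} (hp : p ∉ τ) (hρ : p ∈ ρ) :
    bdry (Pi.single ρ 1) τ = if insert p τ = ρ then (eps p τ : ℝ) else 0 := by
  rw [bdry_apply, Finset.sum_eq_single p]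
  · rw [Pi.single_apply]
    split_ifs <;> simp
  · intro q _ hqp
    rw [Pi.single_eq_of_ne, mul_zero]
    rintro rfl
    exact (Finset.mem_insert.mp hρ).elim (fun h => hqp h.symm) hp
  · simp [hp]

/-- Adding a variable of maximal exponent to an alternator does not lower the linear degree,
unless the form monomial is multilinear. -/
theorem ldeg_insert_of_max (β : ι →₀ ℕ) {p : ι} (hp : ∀ i, β i ≤ β p) (τ : Finset ι) :
    ldeg β (insert p τ) = ldeg β τ ∨
      β.degree ≤ (insert p τ).card + ldeg β (insert p τ) := by
  by_cases h : 2 ≤ β p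
  · left
    unfold ldeg
    congr 1
    ext i
    simp only [Finset.mem_filter, Finset.mem_univ, true_and, Finset.mem_insert, not_or]
    constructor
    · exact fun h => ⟨h.1.2, h.2⟩
    · refine fun h1 => ⟨⟨?_, h1.1⟩, h1.2⟩
      rintro rfl
      omega
  · right
    rw [Finsupp.degree_eq_sum, ldeg, Finset.card_filter, ← degree_ind, Finsupp.degree_eq_sum,
      ← Finset.sum_add_distrib]
    refine Finset.sum_le_sum fun i _ => ?_
    have := hp i
    rw [ind_apply]
    split_ifs with h1 h2 h3
    · omega
    · omega
    · exact h3.2.le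
    · have : ¬ β i = 1 := fun h => h3 ⟨h1, h⟩
      omega

/-- The form monomials counted by the dimension of `𝒮_r Λ^k`. -/
def IsBasic (r k : ℕ) (x : (ι →₀ ℕ) × Finset ι) : Prop :=
  x.2.card = k ∧ x.1.degree ≤ r + ldeg x.1 x.2

/-- Functionals dual, up to nonzero factors, to a basis of `𝒮_r Λ^k`, depending on the choice of a
pivot variable for each weight. -/
noncomputable def dualMap (pv : (ι →₀ ℕ) → ι) (r k : ℕ) :
    PolyForm ι →ₗ[ℝ] ({x : (ι →₀ ℕ) × Finset ι // IsBasic r k x} → ℝ) :=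
  LinearMap.pi fun x =>
    if x.1.1.degree ≤ r then
      LinearMap.proj x.1.2 ∘ₗ comp (x.1.1 + ind x.1.2)
    else if pv (x.1.1 + ind x.1.2) ∈ x.1.2 then
      LinearMap.proj (x.1.2.erase (pv (x.1.1 + ind x.1.2))) ∘ₗ bdry ∘ₗ comp (x.1.1 + ind x.1.2)
    else
      LinearMap.proj x.1.2 ∘ₗ bdry ∘ₗ cobdry (fun i => ((x.1.1 + ind x.1.2) i : ℝ)) ∘ₗ
        comp (x.1.1 + ind x.1.2)

theorem dualMap_apply (pv : (ι →₀ ℕ) → ι) (r k : ℕ) (ω : PolyForm ι)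
    (x : {x : (ι →₀ ℕ) × Finset ι // IsBasic r k x}) {β : ι →₀ ℕ} (hβ : x.1.1 + ind x.1.2 = β) :
    dualMap pv r k ω x =
      if β.degree ≤ k + r then comp β ω x.1.2
      else if pv β ∈ x.1.2 then bdry (comp β ω) (x.1.2.erase (pv β))
      else bdry (cobdry (fun i => (β i : ℝ)) (comp β ω)) x.1.2 := by
  have h : x.1.1.degree ≤ r ↔ β.degree ≤ k + r := by
    rw [← hβ, map_add, degree_ind, x.2.1]
    omega
  rw [dualMap, LinearMap.pi_apply]
  simp only [h, hβ]
  split_ifs <;> rfl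

theorem dualMap_apply_sub (pv : (ι →₀ ℕ) → ι) (r k : ℕ) (ω : PolyForm ι) {β : ι →₀ ℕ}
    {σ : Finset ι} (hσ : ind σ ≤ β) (hx : IsBasic r k (β - ind σ, σ)) :
    dualMap pv r k ω ⟨(β - ind σ, σ), hx⟩ =
      if β.degree ≤ k + r then comp β ω σ
      else if pv β ∈ σ then bdry (comp β ω) (σ.erase (pv β))
      else bdry (cobdry (fun i => (β i : ℝ)) (comp β ω)) σ :=
  dualMap_apply pv r k ω ⟨(β - ind σ, σ), hx⟩ (tsub_add_cancel_of_le hσ)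

/-- Above degree k + r the functionals record κc at the sets σ - pivot and κdc at the sets σ
avoiding the pivot. Any other value off the pivot vanishes automatically, so both cycles are zero,
and Cartan's formula gives c = 0. -/
theorem dualMap_injOn {pv : (ι →₀ ℕ) → ι} (hpv : ∀ (β : ι →₀ ℕ) (i : ι), β i ≤ β (pv β)) {r k : ℕ}
    {ω : PolyForm ι} (hω : ω ∈ serendipity ι r k) (h : dualMap pv r k ω = 0) : ω = 0 := by
  refine eq_zero_of_comp fun β => ?_
  by_cases hβ : β.degree ≤ k + r
  · ext σ
    by_contra h0
    have h0' := h0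
    rw [comp_apply] at h0'
    split_ifs at h0' with h1
    · have hk : σ.card = k := card_eq_of_mem_serendipity hω fun h2 => h0' (by rw [h2]; simp)
      have hd := degree_sub_ind h1
      have hx : IsBasic r k (β - ind σ, σ) := ⟨hk, by dsimp only; omega⟩
      have := congrFun h ⟨_, hx⟩
      rw [dualMap_apply_sub pv r k ω h1, if_pos hβ] at this
      exact h0 this
    · exact h0' rfl
  · push Not at hβ
    obtain ⟨a, b, hc, ha, hb⟩ := exists_comp_eq hω hβ
    have hp1 : 1 ≤ β (pv β) := by
      by_contra h1
      have : β.degree = 0 := by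
        rw [Finsupp.degree_eq_sum]
        exact Finset.sum_eq_zero fun i _ => by have := hpv β i; omega
      omega
    have hdeg : (β.degree : ℝ) ≠ 0 := by
      have : β.degree ≠ 0 := by omega
      exact_mod_cast this
    have hx : bdry (comp β ω) = 0 := by
      refine eq_zero_of_bdry_eq_zero (pv β) (bdry_bdry _) fun τ hτ => ?_
      by_contra h0
      have h0' := h0
      rw [bdry_eq_smul hc, Pi.smul_apply, smul_eq_mul] at h0'
      obtain ⟨q, hq, hbq⟩ := exists_of_bdry_ne_zero (right_ne_zero_of_mul h0')
      obtain ⟨h1, h2, h3⟩ := hb _ hbq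
      -- The superlinear term sits at τ + q. Exchanging q for the pivot gives an index of the dual
      -- system, since maximality of the exponent keeps the linear degree high enough.
      have h4 : ind (insert (pv β) τ) ≤ β := by
        rw [ind_le_iff] at h1 ⊢
        intro i hi
        rcases Finset.mem_insert.mp hi with rfl | hi
        · exact hp1
        · exact h1 i (Finset.mem_insert_of_mem hi)
      have h5 : (insert (pv β) τ).card = k := by
        rw [← h2, Finset.card_insert_of_notMem hτ, Finset.card_insert_of_notMem hq]
      have hd := degree_sub_ind h4
      have h6 := ldeg_insert_of_max β (hpv β) τ
      have h7 := ldeg_insert_le_ldeg β q τ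
      have hb : IsBasic r k (β - ind (insert (pv β) τ), insert (pv β) τ) := ⟨h5, by
        dsimp only
        rw [ldeg_sub_ind]
        omega⟩
      have := congrFun h ⟨_, hb⟩
      rw [dualMap_apply_sub pv r k ω h4, if_neg (by omega),
        if_pos (Finset.mem_insert_self _ _), Finset.erase_insert hτ] at this
      exact h0 this
    have hy : bdry (cobdry (fun i => (β i : ℝ)) (comp β ω)) = 0 := by
      refine eq_zero_of_bdry_eq_zero (pv β) (bdry_bdry _) fun τ hτ => ?_
      by_contra h0
      have h0' := h0
      rw [bdry_cobdry_eq_smul hc, Pi.smul_apply, smul_eq_mul] at h0'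
      obtain ⟨q, hq, haq⟩ := exists_of_bdry_ne_zero (right_ne_zero_of_mul h0')
      obtain ⟨h1, h2, h3⟩ := ha _ haq
      have h4 : ind τ ≤ β := by
        rw [ind_le_iff] at h1 ⊢
        exact fun i hi => h1 i (Finset.mem_insert_of_mem hi)
      rw [Finset.card_insert_of_notMem hq] at h2
      have hd := degree_sub_ind h4
      have h7 := ldeg_insert_le_ldeg β q τ
      have hb : IsBasic r k (β - ind τ, τ) := ⟨by dsimp only; omega, by
        dsimp only
        rw [ldeg_sub_ind]
        omega⟩
      have := congrFun h ⟨_, hb⟩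
      rw [dualMap_apply_sub pv r k ω h4, if_neg (by omega),
        if_neg hτ] at this
      exact h0 this
    have := homotopy (fun i => (β i : ℝ)) (comp β ω)
    rw [hx, hy, map_zero, add_zero, sum_eq_degree] at this
    exact (smul_eq_zero.mp this.symm).resolve_left hdeg

theorem basic_ext {r k : ℕ} {x y : {x : (ι →₀ ℕ) × Finset ι // IsBasic r k x}}
    (h1 : x.1.1 + ind x.1.2 = y.1.1 + ind y.1.2) (h2 : x.1.2 = y.1.2) : x = y := by
  rw [h2] at h1
  exact Subtype.ext (Prod.ext (add_right_cancel h1) h2)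

/-- In low degree the monomial is dual to itself. Above it, dκm serves an alternator containing the
pivot, since dd = 0 removes it from the κd functionals. Otherwise κ of the monomial of equal weight
with the pivot added to the alternator serves, since κκ = 0 removes it from the others. -/
theorem exists_dual_form {pv : (ι →₀ ℕ) → ι} (hpv : ∀ (β : ι →₀ ℕ) (i : ι), β i ≤ β (pv β)) {r k : ℕ} (hr : 1 ≤ r)
    (x : {x : (ι →₀ ℕ) × Finset ι // IsBasic r k x}) :
    ∃ ω ∈ serendipity ι r k, dualMap pv r k ω x ≠ 0 ∧
      ∀ y, y ≠ x → dualMap pv r k ω y = 0 := by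
  obtain ⟨⟨α, σ⟩, hσ, hα⟩ := x
  dsimp only at hσ hα
  set β := α + ind σ with hβ
  have hβd : β.degree = α.degree + k := by rw [hβ, map_add, degree_ind, hσ]
  have hdeg : 0 < β.degree → (β.degree : ℝ) ≠ 0 := fun h => by exact_mod_cast h.ne'
  have hhom : ∀ e : Finset ι → ℝ, bdry (cobdry (fun i => (β i : ℝ)) (bdry e)) =
      (β.degree : ℝ) • bdry e := fun e => bdry_cobdry_eq_smul (a := e) (b := 0) (by simp)
  have hhom' : ∀ e : Finset ι → ℝ, bdry (cobdry (fun i => (β i : ℝ)) (bdry e)) =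
      (β.degree : ℝ) • bdry e := fun e => bdry_eq_smul (a := 0) (b := e) (by simp)
  by_cases h : α.degree ≤ r
  · refine ⟨formMonomial α σ, Submodule.mem_sup_left (Submodule.mem_sup_left
      (Submodule.subset_span ⟨α, σ, hσ, h, rfl⟩)), ?_, ?_⟩
    · rw [dualMap_apply pv r k _ ⟨(α, σ), hσ, hα⟩ hβ.symm, if_pos (by omega), comp_formMonomial, if_pos hβ]
      simp
    · intro y hy
      by_cases hyβ : y.1.1 + ind y.1.2 = β
      · rw [dualMap_apply pv r k _ y hyβ, if_pos (by omega), comp_formMonomial, if_pos hβ,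
          Pi.single_eq_of_ne]
        exact fun h2 => hy (basic_ext hyβ h2)
      · rw [dualMap_apply pv r k _ y rfl, comp_formMonomial, if_neg hyβ]
        simp
  · by_cases hp : pv β ∈ σ
    · refine ⟨extDiff (koszul (formMonomial α σ)), extDiff_koszul_mem_serendipity
        (formMonomial_mem_monoForms ⟨hσ, by omega⟩), ?_, ?_⟩
      · rw [dualMap_apply pv r k _ ⟨(α, σ), hσ, hα⟩ hβ.symm, if_neg (by omega), if_pos hp, comp_extDiff,
          comp_koszul, comp_formMonomial, if_pos hβ, hhom', Pi.smul_apply,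
          bdry_single (by simp) hp, if_pos (Finset.insert_erase hp)]
        exact mul_ne_zero (hdeg (by omega)) (by exact_mod_cast eps_ne_zero _ _)
      · intro y hy
        by_cases hyβ : y.1.1 + ind y.1.2 = β
        · rw [dualMap_apply pv r k _ y hyβ, if_neg (by omega), comp_extDiff,
            comp_koszul, comp_formMonomial, if_pos hβ, hhom', cobdry_cobdry]
          split_ifs with hpy
          · rw [Pi.smul_apply, bdry_single (by simp) hp, if_neg, smul_zero]
            rw [Finset.insert_erase hpy]
            exact fun h2 => hy (basic_ext hyβ h2)
          · simp
        · rw [dualMap_apply pv r k _ y rfl, comp_extDiff, comp_koszul, comp_formMonomial,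
            if_neg hyβ]
          simp
    · have hp1 : 1 ≤ β (pv β) := by
        by_contra h1
        have : β.degree = 0 := by
          rw [Finsupp.degree_eq_sum]
          exact Finset.sum_eq_zero fun i _ => by have := hpv β i; omega
        omega
      have hle : ind (insert (pv β) σ) ≤ β := by
        rw [ind_le_iff]
        intro i hi
        rcases Finset.mem_insert.mp hi with rfl | hi
        · exact hp1
        · simp [hβ, ind_apply, hi]
      have hd := degree_sub_ind hle
      have hβ' : β = β - ind (insert (pv β) σ) + ind (insert (pv β) σ) :=
        (tsub_add_cancel_of_le hle).symm
      have hcard : (insert (pv β) σ).card = k + 1 := by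
        rw [Finset.card_insert_of_notMem hp, hσ]
      refine ⟨koszul (formMonomial (β - ind (insert (pv β) σ)) (insert (pv β) σ)),
        koszul_mem_serendipity (formMonomial_mem_monoForms ⟨hcard, ?_⟩), ?_, ?_⟩
      -- In the multilinear alternative, strict superlinearity comes from r ≥ 1.
      · have h1 := ldeg_insert_of_max β (hpv β) σ
        have h2 : ldeg β σ = ldeg α σ := ldeg_add_ind α σ
        rw [ldeg_sub_ind]
        omega
      · rw [dualMap_apply pv r k _ ⟨(α, σ), hσ, hα⟩ hβ.symm, if_neg (by omega), if_neg hp, comp_koszul,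
          comp_formMonomial, if_pos hβ', hhom, Pi.smul_apply,
          bdry_single hp (Finset.mem_insert_self _ _), if_pos rfl]
        exact mul_ne_zero (hdeg (by omega)) (by exact_mod_cast eps_ne_zero _ _)
      · intro y hy
        by_cases hyβ : y.1.1 + ind y.1.2 = β
        · rw [dualMap_apply pv r k _ y hyβ, if_neg (by omega), comp_koszul, comp_formMonomial,
            if_pos hβ', hhom, bdry_bdry]
          split_ifs with hpy
          · simp
          · rw [Pi.smul_apply, bdry_single hpy (Finset.mem_insert_self _ _), if_neg, smul_zero]
            intro h2
            refine hy (basic_ext hyβ ?_)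
            rw [← Finset.erase_insert hpy, h2, Finset.erase_insert hp]
        · rw [hβ'] at hyβ
          rw [dualMap_apply pv r k _ y rfl, comp_koszul, comp_formMonomial, if_neg hyβ]
          simp

theorem exists_linearEquiv [Nonempty ι] {r : ℕ} (hr : 1 ≤ r) (k : ℕ)
    [Finite {x : (ι →₀ ℕ) × Finset ι // IsBasic r k x}] :
    Nonempty (serendipity ι r k ≃ₗ[ℝ] ({x : (ι →₀ ℕ) × Finset ι // IsBasic r k x} → ℝ)) := by
  classical
  choose pv hpv using fun β : ι →₀ ℕ => Finite.exists_max fun i => β i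
  have := Fintype.ofFinite {x : (ι →₀ ℕ) × Finset ι // IsBasic r k x}
  refine ⟨LinearEquiv.ofBijective ((dualMap pv r k).domRestrict (serendipity ι r k)) ⟨?_, ?_⟩⟩
  · rw [← LinearMap.ker_eq_bot, LinearMap.ker_eq_bot']
    rintro ⟨ω, hω⟩ h
    exact Subtype.ext (dualMap_injOn hpv hω h)
  · rw [← LinearMap.range_eq_top, eq_top_iff, ← (Pi.basisFun ℝ _).span_eq, Submodule.span_le]
    rintro _ ⟨x, rfl⟩
    obtain ⟨ω, hω, h1, h2⟩ := exists_dual_form hpv (k := k) hr x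
    refine ⟨(dualMap pv r k ω x)⁻¹ • ⟨ω, hω⟩, ?_⟩
    rw [map_smul, LinearMap.domRestrict_apply]
    ext y
    rw [Pi.smul_apply, Pi.basisFun_apply, smul_eq_mul]
    by_cases hy : y = x
    · subst hy
      rw [inv_mul_cancel₀ h1, Pi.single_eq_same]
    · rw [h2 y hy, Pi.single_eq_of_ne hy, mul_zero]

theorem finrank_serendipityOn [Nonempty ι] (T : Prism ι) {r : ℕ} (hr : 1 ≤ r) (k : ℕ)
    [Finite {x : (ι →₀ ℕ) × Finset ι // IsBasic r k x}] :
    FiniteDimensional ℝ (serendipityOn T r k) ∧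
      Module.finrank ℝ (serendipityOn T r k) =
        Nat.card {x : (ι →₀ ℕ) × Finset ι // IsBasic r k x} := by
  have := Fintype.ofFinite {x : (ι →₀ ℕ) × Finset ι // IsBasic r k x}
  obtain ⟨e⟩ := exists_linearEquiv (ι := ι) hr k
  let e' := (Submodule.equivMapOfInjective (restrict T) (restrict_injective T)
    (serendipity ι r k)).symm.trans e
  refine ⟨Module.Finite.equiv e'.symm, ?_⟩
  rw [show Module.finrank ℝ (serendipityOn T r k) = _ from e'.finrank_eq,
    Module.finrank_fintype_fun_eq_card, Nat.card_eq_fintype_card]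

/-! ### Counting the basic monomials. -/

/-- The exponents of degree at most `s` in the variables of `f`. -/
def boundedExp (f : Finset ι) (s : ℕ) : Finset (ι →₀ ℕ) :=
  (Finset.range (s + 1)).biUnion f.finsuppAntidiag

theorem mem_boundedExp {f : Finset ι} {s : ℕ} {γ : ι →₀ ℕ} :
    γ ∈ boundedExp f s ↔ γ.support ⊆ f ∧ γ.degree ≤ s := by
  simp only [boundedExp, Finset.mem_biUnion, Finset.mem_range, Finset.mem_finsuppAntidiag]
  constructor
  · rintro ⟨a, ha, h1, h2⟩
    refine ⟨h2, ?_⟩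
    rw [Finsupp.degree_apply, Finset.sum_subset h2 (fun i _ hi => by simpa using hi)]
    exact h1.le.trans (Nat.lt_succ_iff.mp ha)
  · rintro ⟨h1, h2⟩
    refine ⟨γ.degree, by omega, ?_, h1⟩
    rw [Finsupp.degree_apply, Finset.sum_subset h1 (fun i _ hi => by simpa using hi)]

theorem card_boundedExp (f : Finset ι) (s : ℕ) :
    (boundedExp f s).card = (s + f.card).choose f.card := by
  rw [boundedExp, Finset.card_biUnion]
  · simp only [Finset.card_finsuppAntidiag_nat_eq_multichoose, Nat.sum_range_multichoose]
  · intro a _ b _ hab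
    refine Finset.disjoint_left.mpr fun γ h1 h2 => ?_
    rw [Finset.mem_finsuppAntidiag] at h1 h2
    exact hab (h1.1.symm.trans h2.1)

/-- Codes `(f, σ, M, γ)` for form monomials: `M` holds the linear variables outside `σ`, `f` is the
union of `σ` and the variables of exponent at least two, and `γ` is the exponent reduced by two on
`f \ σ`. -/
def codes (ι : Type*) [Fintype ι] [LinearOrder ι] (r k : ℕ) :
    Finset ((_ : Finset ι) × (Finset ι × Finset ι × (ι →₀ ℕ))) :=
  (Finset.univ.filter fun f : Finset ι => 2 * (f.card - k) ≤ r).sigma fun f =>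
    f.powersetCard k ×ˢ fᶜ.powerset ×ˢ boundedExp f (r - 2 * (f.card - k))

/-- The form monomial with a given code. -/
noncomputable def decode (x : (_ : Finset ι) × (Finset ι × Finset ι × (ι →₀ ℕ))) :
    (ι →₀ ℕ) × Finset ι :=
  (x.2.2.2 + 2 • ind (x.1 \ x.2.1) + ind x.2.2.1, x.2.1)

theorem mem_codes {r k : ℕ} {f σ M : Finset ι} {γ : ι →₀ ℕ} :
    (⟨f, σ, M, γ⟩ : (_ : Finset ι) × (Finset ι × Finset ι × (ι →₀ ℕ))) ∈ codes ι r k ↔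
      2 * (f.card - k) ≤ r ∧ (σ ⊆ f ∧ σ.card = k) ∧ Disjoint M f ∧
        γ.support ⊆ f ∧ γ.degree ≤ r - 2 * (f.card - k) := by
  simp only [codes, Finset.mem_sigma, Finset.mem_filter, Finset.mem_univ, true_and,
    Finset.mem_product, Finset.mem_powersetCard, Finset.mem_powerset, mem_boundedExp,
    Finset.subset_compl_iff_disjoint_right]

theorem decode_fst_apply (f σ M : Finset ι) (γ : ι →₀ ℕ) (i : ι) :
    (decode ⟨f, σ, M, γ⟩).1 i =
      γ i + 2 * (if i ∈ f ∧ i ∉ σ then 1 else 0) + if i ∈ M then 1 else 0 := by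
  simp [decode, ind_apply, Finset.mem_sdiff]

theorem decode_injOn (r k : ℕ) : Set.InjOn decode (↑(codes ι r k) : Set ((_ : Finset ι) × (Finset ι × Finset ι × (ι →₀ ℕ)))) := by
  have key : ∀ f σ M : Finset ι, ∀ γ : ι →₀ ℕ, ⟨f, σ, M, γ⟩ ∈ codes ι r k → ∀ i,
      (i ∈ f ↔ i ∈ σ ∨ 2 ≤ (decode ⟨f, σ, M, γ⟩).1 i) ∧
      (i ∈ M ↔ i ∉ σ ∧ (decode ⟨f, σ, M, γ⟩).1 i = 1) := by
    intro f σ M γ h i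
    obtain ⟨-, ⟨h1, -⟩, h2, h3, -⟩ := mem_codes.mp h
    rw [decode_fst_apply]
    by_cases hf : i ∈ f
    · have hM : i ∉ M := fun hM => Finset.disjoint_left.mp h2 hM hf
      by_cases hσ : i ∈ σ <;> simp [hf, hM, hσ]
    · have hσ : i ∉ σ := fun hσ => hf (h1 hσ)
      have hγ : γ i = 0 := by
        by_contra h0
        exact hf (h3 (Finsupp.mem_support_iff.mpr h0))
      by_cases hM : i ∈ M <;> simp [hf, hM, hσ, hγ]
  rintro ⟨f, σ, M, γ⟩ hx ⟨f', σ', M', γ'⟩ hy h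
  have h1 := key f σ M γ hx
  have h2 := key f' σ' M' γ' hy
  obtain rfl : σ = σ' := congrArg Prod.snd h
  rw [h] at h1
  obtain rfl : f = f' := by
    ext i
    rw [(h1 i).1, (h2 i).1]
  obtain rfl : M = M' := by
    ext i
    rw [(h1 i).2, (h2 i).2]
  obtain rfl : γ = γ' := by
    have := congrArg Prod.fst h
    simpa [decode] using this
  rfl

/-- The degree is |γ| + 2|f \ σ| + |M|, and M accounts for the linear degree. Thus deg ≤ r + ldeg
becomes |γ| ≤ r - 2(|f| - k). -/
theorem image_decode (r k : ℕ) :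
    decode '' (↑(codes ι r k) : Set ((_ : Finset ι) × (Finset ι × Finset ι × (ι →₀ ℕ)))) = {x : (ι →₀ ℕ) × Finset ι | IsBasic r k x} := by
  ext ⟨α, τ⟩
  constructor
  · rintro ⟨⟨f, σ, M, γ⟩, hx, h⟩
    obtain ⟨h0, ⟨h1, h1'⟩, h2, h3, h4⟩ := mem_codes.mp hx
    obtain ⟨rfl, rfl⟩ := Prod.mk.inj h
    refine ⟨h1', ?_⟩
    dsimp only
    have hM : M.card ≤ ldeg (γ + 2 • ind (f \ σ) + ind M) σ := by
      refine Finset.card_le_card fun i hi => ?_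
      have hf : i ∉ f := fun hf => Finset.disjoint_left.mp h2 hi hf
      have hγ : γ i = 0 := by
        by_contra h0
        exact hf (h3 (Finsupp.mem_support_iff.mpr h0))
      simp [ind_apply, hf, hγ, hi]
      exact fun hσ => hf (h1 hσ)
    rw [map_add, map_add, map_nsmul, degree_ind, degree_ind, Finset.card_sdiff_of_subset h1, h1',
      smul_eq_mul]
    omega
  · rintro ⟨h1, h2⟩
    dsimp only at h1 h2
    set W := Finset.univ.filter fun i => i ∉ τ ∧ 2 ≤ α i with hW
    set M := Finset.univ.filter fun i => i ∉ τ ∧ α i = 1 with hM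
    set γ : ι →₀ ℕ := α - (2 • ind W + ind M) with hγ
    have hMl : M.card = ldeg α τ := rfl
    have hle : 2 • ind W + ind M ≤ α := by
      intro i
      simp only [Finsupp.add_apply, Finsupp.smul_apply, ind_apply, hW, hM, Finset.mem_filter,
        Finset.mem_univ, true_and, smul_eq_mul]
      split_ifs <;> omega
    have hα : γ + (2 • ind W + ind M) = α := tsub_add_cancel_of_le hle
    have hdis : Disjoint τ W := by
      rw [Finset.disjoint_left]
      intro i hi hi'
      exact (Finset.mem_filter.mp hi').2.1 hi
    have hcard : (τ ∪ W).card = k + W.card := by rw [Finset.card_union_of_disjoint hdis, h1]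
    have hdeg : γ.degree + (2 * W.card + M.card) = α.degree := by
      rw [← hα, map_add, map_add, map_nsmul, degree_ind, degree_ind, smul_eq_mul]
    refine ⟨⟨τ ∪ W, τ, M, γ⟩, ?_, ?_⟩
    · rw [Finset.mem_coe, mem_codes, hcard]
      refine ⟨by omega, ⟨Finset.subset_union_left, h1⟩, ?_, ?_, by omega⟩
      · rw [Finset.disjoint_left]
        intro i hi hi'
        simp only [hM, hW, Finset.mem_filter, Finset.mem_univ, true_and, Finset.mem_union]
          at hi hi'
        rcases hi' with h | h
        · exact hi.1 h
        · omega
      · intro i hi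
        by_contra hc
        simp only [hW, Finset.mem_filter, Finset.mem_univ, true_and, Finset.mem_union,
          not_or, not_and, not_le] at hc
        rw [Finsupp.mem_support_iff] at hi
        apply hi
        have := hc.2 hc.1
        simp only [hγ, Finsupp.tsub_apply, Finsupp.add_apply, Finsupp.smul_apply, ind_apply, hM,
          Finset.mem_filter, Finset.mem_univ, true_and, hc.1, not_false_eq_true]
        split_ifs <;> omega
    · rw [decode]
      dsimp only
      rw [Finset.union_sdiff_cancel_left hdis, add_assoc, hα]

/-- For |f| = d the factors count, in order, the choices of M, f, γ and σ, as r - 2(d - k) + d = r +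
2k - d. -/
theorem card_codes (r k : ℕ) :
    (codes ι r k).card = ∑ d ∈ Finset.Icc k (min (Fintype.card ι) (r / 2 + k)),
      2 ^ (Fintype.card ι - d) * (Fintype.card ι).choose d * (r + 2 * k - d).choose d *
        d.choose k := by
  set n := Fintype.card ι
  have h1 : (codes ι r k).card = ∑ f ∈ (Finset.univ : Finset ι).powerset,
      (fun d => if 2 * (d - k) ≤ r then
        d.choose k * (2 ^ (n - d) * (r - 2 * (d - k) + d).choose d) else 0) f.card := by
    rw [codes, Finset.card_sigma, Finset.sum_filter, Finset.powerset_univ]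
    refine Finset.sum_congr rfl fun f _ => ?_
    dsimp only
    rw [Finset.card_product, Finset.card_product, Finset.card_powersetCard, Finset.card_powerset,
      Finset.card_compl, card_boundedExp]
  rw [h1, Finset.sum_powerset_apply_card (fun d => if 2 * (d - k) ≤ r then
    d.choose k * (2 ^ (n - d) * (r - 2 * (d - k) + d).choose d) else 0), Finset.card_univ]
  symm
  refine Finset.sum_subset_zero_on_sdiff ?_ ?_ ?_
  · intro d hd
    rw [Finset.mem_Icc] at hd
    rw [Finset.mem_range]
    omega
  · intro d hd
    simp only [Finset.mem_sdiff, Finset.mem_range, Finset.mem_Icc] at hd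
    split_ifs with h
    -- For d < k truncated subtraction makes the condition on d hold, and it is the binomial
    -- coefficient d choose k that removes the term.
    · rw [Nat.choose_eq_zero_of_lt (show d < k by omega)]
      simp
    · simp
  · intro d hd
    rw [Finset.mem_Icc] at hd
    rw [if_pos (by omega), show r - 2 * (d - k) + d = r + 2 * k - d by omega, smul_eq_mul]
    ring

end SerendipityForms

open SerendipityForms in
theorem theorem3p5 (n r k : ℕ) (hn : 1 ≤ n) (hr : 1 ≤ r) (hk : k ≤ n) (T : Prism (Fin n)) :
    (FiniteDimensional ℝ (serendipityOn T r k) ∧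
      Module.finrank ℝ (serendipityOn T r k) =
        ∑ d ∈ Finset.Icc k (min n (r / 2 + k)),
          2 ^ (n - d) * n.choose d * (r + 2 * k - d).choose d * d.choose k) ∧
    ∀ μ ∈ serendipityOn T r k,
      (∀ d : ℕ, k ≤ d → d ≤ min n (r / 2 + k) → ∀ f : Face (Fin n) d,
        ∀ ν ∈ polyFormsOn (f.prism T) (r - 2 * (d - k)) (d - k),
          integral (f.prism T) (wedge (f.trace T μ) ν) = 0) →
      μ = 0 := by
  have : Nonempty (Fin n) := ⟨⟨0, hn⟩⟩
  have himage := image_decode (ι := Fin n) r k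
  have : Finite {x : (Fin n →₀ ℕ) × Finset (Fin n) // IsBasic r k x} :=
    (himage ▸ (codes (Fin n) r k).finite_toSet.image decode :
      {x : (Fin n →₀ ℕ) × Finset (Fin n) | IsBasic r k x}.Finite)
  refine ⟨?_, fun μ hμ hm => unisolvence T hμ ?_⟩
  · obtain ⟨h1, h2⟩ := finrank_serendipityOn T hr k
    refine ⟨h1, ?_⟩
    have h3 : Nat.card {x : (Fin n →₀ ℕ) × Finset (Fin n) // IsBasic r k x} =
        (codes (Fin n) r k).card := by
      change Nat.card {x : (Fin n →₀ ℕ) × Finset (Fin n) | IsBasic r k x} = _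
      rw [Nat.card_coe_set_eq, ← himage, (decode_injOn r k).ncard_image,
        Set.ncard_coe_finset]
    rw [h2, h3, card_codes, Fintype.card_fin]
  · rwa [Fintype.card_fin]
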